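/- Let $r\ge 1$ and let $(a_n)_{n\in\mathbb Z}$, $(b_n)_{n\in\mathbb Z}$ be $r$-periodic complex sequences ($a_{n+r}=a_n$, $b_{n+r}=b_n$) with $b_n\neq 0$ for all $n$. Let $J_r$ be the bounded operator on $\ell^2(\mathbb Z)$ given by $$(J_rf)_n=b_{n-1}f_{n-1}+a_nf_n+b_nf_{n+1},$$ and let $K=\sigma(J_r)\subset\mathbb C$ be its spectrum. Put $\mathcal B=\prod_{n=1}^r b_n$ and $\beta=2|\mathcal B|$. For integers $i\le j$ let $\Delta(i,j)$ be the determinant, a polynomial in $z$, of the symmetric tridiagonal matrix with diagonal $a_i-z,\dots,a_j-z$ and off-diagonal $b_i,\dots,b_{j-1}$, with $\Delta(i,i-1)=1$ and $\Delta(i,j)=0$ for $j<i-1$. Let $$P(z)=(-1)^r\bigl[\Delta(1,r)-b_r^2\,\Delta(2,r-1)\bigr],\qquad \widetilde P=\frac1{\mathcal B}P,\qquad P_n=\beta^{-n}\,T_n(\widetilde P),$$ where $P$ is the Naĭman polynomial of $J_r$ and $T_n$ is the Chebyshev polynomial of $[-2,2]$, $T_n(2\cos\theta)=2\cos n\theta$.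 For a compactly supported probability measure $\mu$ on $\mathbb C$ let $I(\mu)=\iint\log\frac1{|z-w|}\,d\mu(z)\,d\mu(w)\in(-\infty,+\infty]$. The capacity of $K$ is $\mathcal C(K)=e^{-v(K)}$, where $v(K)$ is the infimum of $I(\mu)$ over the probability measures $\mu$ supported in $K$. If $\mathcal C(K)\ne0$, an equilibrium measure of $K$ is a probability measure $\mu$ supported in $K$ with $I(\mu)=\log(1/\mathcal C(K))$. For a nonconstant polynomial $Q$ let $\mu_Q=\frac1{\deg Q}\sum_x\delta_x$, the sum being over the complex zeros $x$ of $Q$ counted with multiplicity. Then: 1. For every $n\ge1$, $P_n$ divided by its leading coefficient is a Chebyshev polynomial of degree $nr$ of $K$: it is monic of degree $nr$ and has the least sup-norm on $K$ among the monic complex polynomials of degree $nr$. 2. $K$ has nonzero capacity and a unique equilibrium measure $\mu_K$, and $\mu_{P_n}\to\mu_K$ weakly as $n\to\infty$. 3. For every integer $l\ge1$, $\mu_{P_n^l}\to\mu_K$ weakly as $n\to\infty$, where $P_n^l$ is the $l$-th power of $P_n$. -/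

import Mathlib

open Filter Topology MeasureTheory Polynomial
open scoped ENNReal NNReal

noncomputable section

/-! ## Two-sided Jacobi operators on `ℓ²(ℤ)` -/

/-- The space `ℓ²(ℤ)` of square-summable two-sided complex sequences. -/
abbrev EllTwo : Type := lp (fun _ : ℤ => ℂ) 2

/-- The space `ℓ^∞(ℤ)` of bounded two-sided complex sequences. -/
abbrev EllInfty : Type := lp (fun _ : ℤ => ℂ) ∞

/-- The translation `f ↦ (n ↦ f (n + k))` of `ℓ²(ℤ)`. -/
def shiftOp (k : ℤ) : EllTwo →L[ℂ] EllTwo :=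
  LinearMap.mkContinuous
    { toFun := fun f => ⟨fun n => f (n + k), by
        have h := (lp.memℓp f).summable (by norm_num)
        exact memℓp_gen (h.comp_injective (add_left_injective k))⟩
      map_add' := fun f g => by ext n; rfl
      map_smul' := fun c f => by ext n; rfl } 1 (fun f => by
    rw [one_mul]
    refine le_of_eq ?_
    rw [lp.norm_eq_tsum_rpow (by norm_num), lp.norm_eq_tsum_rpow (by norm_num)]
    congr 1
    exact (Equiv.addRight k).tsum_eq (fun n => ‖f n‖ ^ (2 : ℝ≥0∞).toReal))

theorem norm_mul_apply_le (c : EllInfty) (f : EllTwo) (n : ℤ) :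
    ‖c n * f n‖ ≤ ‖((‖c‖ : ℂ) • f) n‖ := by
  have hc : ‖c n‖ ≤ ‖c‖ := lp.norm_apply_le_norm ENNReal.top_ne_zero c n
  simp only [lp.coeFn_smul, Pi.smul_apply, norm_smul, norm_mul, Complex.norm_real, norm_norm]
  exact mul_le_mul_of_nonneg_right hc (norm_nonneg _)

/-- The multiplication `f ↦ (n ↦ c n * f n)` of `ℓ²(ℤ)` by a bounded sequence `c`. -/
def diagOp (c : EllInfty) : EllTwo →L[ℂ] EllTwo :=
  LinearMap.mkContinuous
    { toFun := fun f => ⟨fun n => c n * f n,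
        Memℓp.mono' (lp.memℓp ((‖c‖ : ℂ) • f)) (norm_mul_apply_le c f)⟩
      map_add' := fun f g => by ext n; exact mul_add _ _ _
      map_smul' := fun k f => by ext n; exact mul_left_comm _ _ _ } ‖c‖ (fun f => by
    have h1 : ‖(‖c‖ : ℂ) • f‖ = ‖c‖ * ‖f‖ := by
      rw [norm_smul, Complex.norm_real, norm_norm]
    rw [← h1]
    exact lp.norm_mono (by norm_num) (norm_mul_apply_le c f))

/-- The two-sided Jacobi operator with diagonal `a` and off-diagonal `b`:
`(J f) n = b (n - 1) * f (n - 1) + a n * f n + b n * f (n + 1)`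
(see `jacobiOp_apply`). -/
def jacobiOp (a b : EllInfty) : EllTwo →L[ℂ] EllTwo :=
  (shiftOp (-1)).comp (diagOp b) + diagOp a + (diagOp b).comp (shiftOp 1)

theorem jacobiOp_apply (a b : EllInfty) (f : EllTwo) (n : ℤ) :
    jacobiOp a b f n = b (n - 1) * f (n - 1) + a n * f n + b n * f (n + 1) := rfl

/-! ## The modulus and the Naiman polynomial of an `r`-periodic Jacobi matrix -/

/-- The modulus `b 1 * ... * b r`. -/
def jacobiModulus (r : ℕ) (b : ℤ → ℂ) : ℂ := ∏ n ∈ Finset.Icc 1 r, b (n : ℤ)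

/-- The `m × m` symmetric tridiagonal matrix with diagonal `a i - z, ..., a (i + m - 1) - z` and
off-diagonal `b i, ..., b (i + m - 2)`, over the polynomials in the variable `z`. -/
def jacobiBlock (a b : ℤ → ℂ) (i : ℤ) (m : ℕ) : Matrix (Fin m) (Fin m) ℂ[X] :=
  Matrix.of fun s t =>
    if s = t then C (a (i + (s : ℕ))) - X
    else if (s : ℕ) + 1 = t then C (b (i + (s : ℕ)))
    else if (t : ℕ) + 1 = s then C (b (i + (t : ℕ)))
    else 0

/-- The determinant `Δ(i, j)` of the block with rows and columns `i, ..., j`, with the usual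
conventions `Δ(i, i - 1) = 1` and `Δ(i, j) = 0` for `j < i - 1`. -/
def jacobiDelta (a b : ℤ → ℂ) (i j : ℤ) : ℂ[X] :=
  if j + 1 < i then 0 else (jacobiBlock a b i (j + 1 - i).toNat).det

/-- The Naiman polynomial `P(z) = (-1)^r (Δ(1, r) - b_r² Δ(2, r - 1))`, characterized by
`det (C_h - z) = (-1)^(r+1) (𝓑 (h + h⁻¹) - P(z))`, where `C_h` is the `r × r` matrix of `J` acting
on the sequences with `f (n + r) = h f n` and `𝓑` is the modulus. -/
def naimanPoly (r : ℕ) (a b : ℤ → ℂ) : ℂ[X] :=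
  (-1) ^ r * (jacobiDelta a b 1 r - C (b r ^ 2) * jacobiDelta a b 2 ((r : ℤ) - 1))

/-- The normalized polynomial `P / 𝓑`. -/
def naimanTilde (r : ℕ) (a b : ℤ → ℂ) : ℂ[X] :=
  C (jacobiModulus r b)⁻¹ * naimanPoly r a b

/-- `P_n = β⁻ⁿ T_n(P / 𝓑)`, where `β = 2 |𝓑|` and `T_n` is the Chebyshev polynomial of `[-2, 2]`,
that is `T_n (2 cos θ) = 2 cos (n θ)`. -/
def chebPoly (r : ℕ) (a b : ℤ → ℂ) (n : ℕ) : ℂ[X] :=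
  C (((2 * ‖jacobiModulus r b‖ : ℝ) : ℂ) ^ n)⁻¹ *
    (Polynomial.Chebyshev.C ℂ (n : ℤ)).comp (naimanTilde r a b)

/-- `T` is a Chebyshev polynomial of degree `N` of `K`: it is monic of degree `N` and has the least
sup-norm on `K` among the monic polynomials of degree `N`. -/
def IsChebyshevPolynomial (K : Set ℂ) (N : ℕ) (T : ℂ[X]) : Prop :=
  T.Monic ∧ T.natDegree = N ∧
    ∀ q : ℂ[X], q.Monic → q.natDegree = N →
      (⨆ z ∈ K, ‖T.eval z‖ₑ) ≤ ⨆ z ∈ K, ‖q.eval z‖ₑ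

/-! ## Zero counting measures and equilibrium measures -/

/-- The normalized zero counting measure `(deg p)⁻¹ ∑ δ_x`, the sum being over the zeros `x` of `p`
with multiplicity (the zero measure if `p` is constant). -/
def zeroCountingMeasure (p : ℂ[X]) : FiniteMeasure ℂ :=
  (p.natDegree : ℝ≥0)⁻¹ • (p.roots.map fun x => (diracProba x).toFiniteMeasure).sum

/-- The logarithmic kernel `log (1 / |z - w|)`, equal to `+∞` on the diagonal. -/
def logKernel (z w : ℂ) : EReal :=
  if z = w then ⊤ else ((-Real.log ‖z - w‖ : ℝ) : EReal)

/-- The logarithmic energy `I(μ) = ∬ log (1 / |z - w|) dμ(z) dμ(w)` as the difference of the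
integrals of the positive and the negative part of the kernel; for a compactly supported
probability measure the second one is finite, and the energy lies in `(-∞, +∞]`. -/
def logEnergy (μ : ProbabilityMeasure ℂ) : EReal :=
  ((∫⁻ z, ∫⁻ w, (logKernel z w).toENNReal ∂(μ : Measure ℂ) ∂(μ : Measure ℂ) : ℝ≥0∞) : EReal) -
    ((∫⁻ z, ∫⁻ w, (-logKernel z w).toENNReal ∂(μ : Measure ℂ) ∂(μ : Measure ℂ) : ℝ≥0∞) : EReal)

/-- `v(K)`, the infimum of the energies of the probability measures supported in `K`. -/
def minEnergy (K : Set ℂ) : EReal :=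
  ⨅ (μ : ProbabilityMeasure ℂ) (_ : (μ : Measure ℂ) Kᶜ = 0), logEnergy μ

/-- The logarithmic capacity `exp (-v(K))`. -/
def logCapacity (K : Set ℂ) : ℝ≥0∞ := EReal.exp (-minEnergy K)

/-- `μ` is an equilibrium measure of the compact set `K`: `K` has nonzero capacity, and `μ` is a
probability measure supported in `K` with `I(μ) = log (1 / capacity)`. -/
def IsEquilibriumMeasure (K : Set ℂ) (μ : ProbabilityMeasure ℂ) : Prop :=
  logCapacity K ≠ 0 ∧ (μ : Measure ℂ) Kᶜ = 0 ∧ logEnergy μ = ENNReal.log (logCapacity K)⁻¹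

end

/-!
Let `Q = P / 𝓑` be the normalized Naiman polynomial. Everything rests on the equality of the
spectrum `K` with `Q⁻¹([-2, 2])`; afterwards only the polynomial `Q` matters.

*The spectrum.* By the Cayley–Hamilton theorem the monodromy matrix over one period, of determinant
`1` and trace `Q`, gives `x (n + 2r) + x n = Q • x (n + r)` for the solutions `x` of the Jacobi
recurrence. This is proved over an arbitrary `ℂ[X]`-module (`IsJacobiSolution.monodromy`). The unit
vectors of `ℓ²(ℤ)` are a solution when `X` acts as the Jacobi operator `J`, hence
`Q(J) = U + U⁻¹` with `U` the shift by `r` (`aeval_jacobiOp_naimanTilde`). The right-hand side is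
self-adjoint of norm at most `2`, and spectral mapping gives `K ⊆ Q⁻¹([-2, 2])`. Conversely, if
`Q(z) = h + h⁻¹` with `|h| = 1`, the scalar recurrence has a nonzero solution whose modulus is
`r`-periodic. Its truncations have norms tending to infinity while `J - z` maps them to bounded
boundary terms, so `z ∈ K` (`spectrum_jacobiOp`).

*Extremality.* Let `q` be monic of degree `n r`. By Newton's identities its sum over the fibre
`Q⁻¹(w)` is a polynomial in `w` of degree `n` whose top coefficient is determined by `Q`
(`exists_rootSum_eq_eval`). The Chebyshev inequality on `[-2, 2]` bounds that coefficient
(`two_mul_norm_coeff_le`), which yields the lower bound that the composition `T_n ∘ Q` attains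
(`isChebyshevPolynomial_comp`).

*The equilibrium measure.* Frullani's integral writes `log (R / |z - w|)` as a superposition of the
kernels `exp (-t |z - w|²)` up to constants, and a Gaussian is the Fourier transform of a Gaussian;
since characteristic functions separate measures, the energy is strictly positive definite on
probability measures (`two_mul_mutualEnergy_lt`). A probability measure on `K` of constant potential
is therefore the only equilibrium measure (`isEquilibriumMeasure_of_potential_const`). The mean of
the uniform measures on the fibres of `Q` with respect to the arcsine distribution of `[-2, 2]` is
such a measure (`potential_arcsinePullback`): the potential of a fibre is an affine function of
`log |Q(z) - y|`, and the arcsine distribution has potential zero on `[-2, 2]`.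

*The zeros.* The zeros of `T_n ∘ Q` form the fibres above the points `2 cos (π (2k + 1) / (2n))`.
Sums over the fibres are continuous in the base point (`continuous_fibreSum`), so the integrals of a
test function are midpoint Riemann sums that converge to its integral against the equilibrium
measure (`tendsto_zeroCountingMeasure_comp`). Powers have the same zero counting measures.
-/

noncomputable section

/-! ### Continuants -/

/-- The three-term recurrence of the continuants, by expansion along the last row. -/
theorem det_jacobiBlock_succ_succ (a b : ℤ → ℂ) (i : ℤ) (m : ℕ) :
    (jacobiBlock a b i (m + 2)).det =
      (C (a (i + (m + 1 : ℕ))) - X) * (jacobiBlock a b i (m + 1)).det -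
        C (b (i + m) ^ 2) * (jacobiBlock a b i m).det := by
  have hlast : (jacobiBlock a b i (m + 2)).submatrix (Fin.last (m + 1)).succAbove
      (Fin.last (m + 1)).succAbove = jacobiBlock a b i (m + 1) := by
    ext s t
    simp [jacobiBlock, Fin.ext_iff]
  have hcorner : ((jacobiBlock a b i (m + 2)).submatrix (Fin.last (m + 1)).succAbove
      (Fin.last m).castSucc.succAbove).det = C (b (i + m)) * (jacobiBlock a b i m).det := by
    rw [Matrix.det_succ_column _ (Fin.last m), Fin.sum_univ_castSucc, Finset.sum_eq_zero]
    · have h2 : ((jacobiBlock a b i (m + 2)).submatrix (Fin.last (m + 1)).succAbove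
          (Fin.last m).castSucc.succAbove).submatrix (Fin.last m).succAbove
          (Fin.last m).succAbove = jacobiBlock a b i m := by
        ext s t
        have ht : (Fin.last m).castSucc.succAbove t.castSucc = t.castSucc.castSucc := by
          rw [Fin.succAbove_of_castSucc_lt]
          simp
        simp [jacobiBlock, Fin.ext_iff, ht]
      rw [h2]
      have ht : (Fin.last m).castSucc.succAbove (Fin.last m) = Fin.last (m + 1) := by
        rw [Fin.succAbove_of_le_castSucc]
        · simp
        · simp
      simp [jacobiBlock, Fin.ext_iff, ht, ← two_mul, pow_mul]
    · intro s _
      have ht : (Fin.last m).castSucc.succAbove (Fin.last m) = Fin.last (m + 1) := by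
        rw [Fin.succAbove_of_le_castSucc]
        · simp
        · simp
      have h1 := s.isLt
      have : jacobiBlock a b i (m + 2) s.castSucc.castSucc (Fin.last (m + 1)) = 0 := by
        simp only [jacobiBlock, Matrix.of_apply, Fin.ext_iff, Fin.val_castSucc, Fin.val_last]
        rw [if_neg (by omega), if_neg (by omega), if_neg (by omega)]
      simp [ht, this]
  rw [Matrix.det_succ_row _ (Fin.last (m + 1)), Fin.sum_univ_castSucc, Fin.sum_univ_castSucc,
    Finset.sum_eq_zero, hlast, hcorner]
  · have e1 : jacobiBlock a b i (m + 2) (Fin.last (m + 1)) (Fin.last m).castSucc =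
        C (b (i + m)) := by
      simp only [jacobiBlock, Matrix.of_apply, Fin.ext_iff, Fin.val_castSucc, Fin.val_last]
      rw [if_neg (by omega), if_neg (by omega), if_pos trivial]
    have e2 : jacobiBlock a b i (m + 2) (Fin.last (m + 1)) (Fin.last (m + 1)) =
        C (a (i + (m + 1 : ℕ))) - X := by
      simp [jacobiBlock]
    rw [e1, e2]
    have s1 : (-1 : ℂ[X]) ^ (((Fin.last (m + 1) : Fin (m + 2)) : ℕ) +
        (((Fin.last m).castSucc : Fin (m + 2)) : ℕ)) = -1 := by
      simp only [Fin.val_last, Fin.val_castSucc]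
      exact Odd.neg_one_pow ⟨m, by ring⟩
    have s2 : (-1 : ℂ[X]) ^ (((Fin.last (m + 1) : Fin (m + 2)) : ℕ) +
        ((Fin.last (m + 1) : Fin (m + 2)) : ℕ)) = 1 :=
      Even.neg_one_pow ⟨_, rfl⟩
    rw [s1, s2, C_pow]
    ring
  · intro t _
    have h1 := t.isLt
    have : jacobiBlock a b i (m + 2) (Fin.last (m + 1)) t.castSucc.castSucc = 0 := by
      simp only [jacobiBlock, Matrix.of_apply, Fin.ext_iff, Fin.val_castSucc, Fin.val_last]
      rw [if_neg (by omega), if_neg (by omega), if_neg (by omega)]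
    simp [this]

theorem jacobiDelta_eq_det (a b : ℤ → ℂ) (i : ℤ) (m : ℕ) :
    jacobiDelta a b i (i - 1 + m) = (jacobiBlock a b i m).det := by
  have h : (i - 1 + (m : ℤ) + 1 - i).toNat = m := by omega
  rw [jacobiDelta, if_neg (by omega), h]

/-- The continuants `Δ(1, n)`, indexed by natural numbers. -/
abbrev firstContinuant (a b : ℤ → ℂ) (n : ℕ) : ℂ[X] := jacobiDelta a b 1 n

/-- The continuants `Δ(2, n)`, indexed by natural numbers. -/
abbrev secondContinuant (a b : ℤ → ℂ) (n : ℕ) : ℂ[X] := jacobiDelta a b 2 n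

theorem firstContinuant_eq_det (a b : ℤ → ℂ) (n : ℕ) :
    firstContinuant a b n = (jacobiBlock a b 1 n).det := by
  rw [← jacobiDelta_eq_det]; simp [firstContinuant]

theorem secondContinuant_succ_eq_det (a b : ℤ → ℂ) (n : ℕ) :
    secondContinuant a b (n + 1) = (jacobiBlock a b 2 n).det := by
  rw [← jacobiDelta_eq_det, secondContinuant]
  congr 1; push_cast; ring

theorem firstContinuant_zero (a b : ℤ → ℂ) : firstContinuant a b 0 = 1 := by
  simp [firstContinuant_eq_det]

theorem firstContinuant_one (a b : ℤ → ℂ) : firstContinuant a b 1 = C (a 1) - X := by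
  simp [firstContinuant_eq_det, jacobiBlock]

theorem firstContinuant_succ_succ (a b : ℤ → ℂ) (n : ℕ) :
    firstContinuant a b (n + 2) = (C (a (n + 2 : ℕ)) - X) * firstContinuant a b (n + 1) -
      C (b (n + 1 : ℕ) ^ 2) * firstContinuant a b n := by
  simp only [firstContinuant_eq_det, det_jacobiBlock_succ_succ]
  rw [show (1 : ℤ) + (n + 1 : ℕ) = (n + 2 : ℕ) by push_cast; ring,
    show (1 : ℤ) + n = (n + 1 : ℕ) by push_cast; ring]

theorem secondContinuant_zero (a b : ℤ → ℂ) : secondContinuant a b 0 = 0 := by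
  simp [secondContinuant, jacobiDelta]

theorem secondContinuant_one (a b : ℤ → ℂ) : secondContinuant a b 1 = 1 := by
  simpa using secondContinuant_succ_eq_det a b 0

theorem secondContinuant_succ_succ (a b : ℤ → ℂ) (n : ℕ) :
    secondContinuant a b (n + 2) = (C (a (n + 2 : ℕ)) - X) * secondContinuant a b (n + 1) -
      C (b (n + 1 : ℕ) ^ 2) * secondContinuant a b n := by
  rcases n with _ | n
  · rw [secondContinuant_succ_eq_det, secondContinuant_one, secondContinuant_zero]
    simp [jacobiBlock]
  · simp only [secondContinuant_succ_eq_det, det_jacobiBlock_succ_succ]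
    rw [show (2 : ℤ) + (n + 1 : ℕ) = (n + 1 + 2 : ℕ) by push_cast; ring,
      show (2 : ℤ) + n = (n + 1 + 1 : ℕ) by push_cast; ring]

/-- A block of size `n` has determinant `(-X)ⁿ` up to lower order terms. -/
theorem natDegree_coeff_det_jacobiBlock (a b : ℤ → ℂ) (i : ℤ) (n : ℕ) :
    (jacobiBlock a b i n).det.natDegree ≤ n ∧
      (jacobiBlock a b i n).det.coeff n = (-1) ^ n := by
  induction n using Nat.twoStepInduction with
  | zero => simp
  | one =>
    simp only [jacobiBlock, Matrix.det_unique, Matrix.of_apply]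
    refine ⟨?_, by simp⟩
    simpa using natDegree_sub_le (C (a i)) X
  | more n ih1 ih2 =>
    rw [det_jacobiBlock_succ_succ]
    have h0 : (jacobiBlock a b i n).det.coeff (n + 2) = 0 :=
      coeff_eq_zero_of_natDegree_lt (by omega)
    have h1 : (jacobiBlock a b i (n + 1)).det.coeff (n + 2) = 0 :=
      coeff_eq_zero_of_natDegree_lt (by omega)
    constructor
    · refine (natDegree_sub_le _ _).trans (max_le ?_ ?_)
      · refine natDegree_mul_le.trans ?_
        have : (C (a (i + (n + 1 : ℕ))) - X).natDegree ≤ 1 := by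
          simpa using natDegree_sub_le (C (a (i + (n + 1 : ℕ)))) X
        omega
      · exact (natDegree_C_mul_le _ _).trans (by omega)
    · rw [coeff_sub, coeff_C_mul, h0, sub_mul, coeff_sub, coeff_C_mul, h1, coeff_X_mul, ih2.2]
      ring

/-- The Naiman polynomial is monic of degree `r`, stated through the degree bound and the top
coefficient. -/
theorem natDegree_coeff_naimanPoly (r : ℕ) (hr : 0 < r) (a b : ℤ → ℂ) :
    (naimanPoly r a b).natDegree ≤ r ∧ (naimanPoly r a b).coeff r = 1 := by
  obtain ⟨s, rfl⟩ := Nat.exists_eq_add_of_lt hr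
  rw [zero_add]
  have h2 : jacobiDelta a b 2 (((s + 1 : ℕ) : ℤ) - 1) = secondContinuant a b s := by
    simp [secondContinuant]
  have hd : (secondContinuant a b s).natDegree < s + 1 := by
    rcases s with _ | s
    · simp [secondContinuant_zero]
    · rw [secondContinuant_succ_eq_det]
      exact (natDegree_coeff_det_jacobiBlock a b 2 s).1.trans_lt (by omega)
  have h1 := natDegree_coeff_det_jacobiBlock a b 1 (s + 1)
  rw [← firstContinuant_eq_det] at h1
  have hneg : ((-1 : ℂ[X]) ^ (s + 1)) = C ((-1) ^ (s + 1)) := by simp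
  rw [naimanPoly, h2, hneg]
  constructor
  · exact (natDegree_C_mul_le _ _).trans ((natDegree_sub_le _ _).trans
      (max_le h1.1 ((natDegree_C_mul_le _ _).trans hd.le)))
  · rw [coeff_C_mul, coeff_sub, h1.2, coeff_C_mul, coeff_eq_zero_of_natDegree_lt hd, mul_zero,
      sub_zero, ← mul_pow]
    simp

/-! ### The Jacobi recurrence and the monodromy relation -/

/-- The partial product `b 1 * ... * b n`. -/
def offDiagProd (b : ℤ → ℂ) (n : ℕ) : ℂ := ∏ k ∈ Finset.Icc 1 n, b (k : ℤ)

theorem offDiagProd_succ (b : ℤ → ℂ) (n : ℕ) :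
    offDiagProd b (n + 1) = offDiagProd b n * b (n + 1 : ℕ) := by
  rw [offDiagProd, offDiagProd, Finset.prod_Icc_succ_top (by omega)]

theorem offDiagProd_zero (b : ℤ → ℂ) : offDiagProd b 0 = 1 := by simp [offDiagProd]

theorem offDiagProd_ne_zero (b : ℤ → ℂ) (hb : ∀ n, b n ≠ 0) (n : ℕ) : offDiagProd b n ≠ 0 :=
  Finset.prod_ne_zero_iff.2 fun _ _ => hb _

/-- The Wronskian identity for the two families of continuants. -/
theorem continuant_wronskian (a b : ℤ → ℂ) (n : ℕ) :
    firstContinuant a b (n + 1) * secondContinuant a b n -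
      firstContinuant a b n * secondContinuant a b (n + 1) = -C (offDiagProd b n) ^ 2 := by
  induction n with
  | zero => simp [firstContinuant_zero, secondContinuant_zero, secondContinuant_one,
      offDiagProd_zero]
  | succ n ih =>
    rw [firstContinuant_succ_succ, secondContinuant_succ_succ, offDiagProd_succ, C_mul, C_pow]
    linear_combination C (b (n + 1 : ℕ)) ^ 2 * ih

/-- `x : ℕ → M` solves the Jacobi recurrence, the spectral parameter being the action of `X` on
the `ℂ[X]`-module `M`. -/
def IsJacobiSolution {M : Type*} [AddCommGroup M] [Module ℂ[X] M] (a b : ℤ → ℂ) (x : ℕ → M) :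
    Prop :=
  ∀ n : ℕ, C (b n) • x n + C (a (n + 1 : ℕ)) • x (n + 1) + C (b (n + 1 : ℕ)) • x (n + 2) =
    (X : ℂ[X]) • x (n + 1)

section Module

variable {M : Type*} [AddCommGroup M] [Module ℂ[X] M] {a b : ℤ → ℂ} {x : ℕ → M}

/-- The continuants are the entries of the transfer matrix: a solution is expressed through its
first two terms. The denominator `b 1 * ... * b n` is cleared. -/
theorem IsJacobiSolution.eq_continuants (hx : IsJacobiSolution a b x) (n : ℕ) :
    C (offDiagProd b n) • x (n + 1) =
      ((-1) ^ n * firstContinuant a b n) • x 1 +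
        ((-1) ^ n * (C (b 0) * secondContinuant a b n)) • x 0 := by
  induction n using Nat.twoStepInduction with
  | zero => simp [offDiagProd_zero, firstContinuant_zero, secondContinuant_zero]
  | one =>
    have h := hx 0
    rw [offDiagProd_succ, offDiagProd_zero, firstContinuant_one, secondContinuant_one, C_mul]
    simp only [zero_add, Nat.cast_one, Nat.cast_zero, C_1] at h ⊢
    linear_combination (norm := module) h
  | more n ih1 ih2 =>
    have h := hx (n + 1)
    rw [firstContinuant_succ_succ, secondContinuant_succ_succ, offDiagProd_succ b (n + 1), C_mul,
      C_pow]
    rw [offDiagProd_succ, C_mul] at ih2 ⊢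
    simp only [add_assoc, Nat.reduceAdd] at h ih1 ih2 ⊢
    linear_combination (norm := module) (C (offDiagProd b n) * C (b (n + 1 : ℕ))) • h +
      (X - C (a (n + 2 : ℕ)) : ℂ[X]) • ih2 - (C (b (n + 1 : ℕ)) ^ 2) • ih1

theorem IsJacobiSolution.shift {r : ℕ} (ha : ∀ n, a (n + r) = a n) (hb : ∀ n, b (n + r) = b n)
    (hx : IsJacobiSolution a b x) : IsJacobiSolution a b fun n => x (n + r) := by
  intro n
  have h := hx (n + r)
  have e : ((n + r + 1 : ℕ) : ℤ) = (n + 1 : ℕ) + r := by push_cast; ring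
  rw [e, ha, hb, Nat.cast_add, hb] at h
  rw [show n + r + 1 = n + 1 + r by omega, show n + r + 2 = n + 2 + r by omega] at h
  exact h

theorem C_smul_cancel {c : ℂ} (hc : c ≠ 0) {u v : M} (h : C c • u = C c • v) : u = v := by
  have h2 := congrArg (fun w => C c⁻¹ • w) h
  simpa [smul_smul, ← C_mul, inv_mul_cancel₀ hc] using h2

/-- The recurrence can be solved forwards because `b` does not vanish. -/
theorem IsJacobiSolution.eq_zero (hb0 : ∀ n, b n ≠ 0) (hx : IsJacobiSolution a b x)
    (h0 : x 0 = 0) (h1 : x 1 = 0) (n : ℕ) : x n = 0 := by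
  rcases n with _ | n
  · exact h0
  · refine C_smul_cancel (offDiagProd_ne_zero b hb0 n) ?_
    rw [hx.eq_continuants, h0, h1]
    simp

/-- The Cayley–Hamilton relation of the monodromy matrix: its determinant is `1` and its trace is
the normalized Naiman polynomial. -/
theorem IsJacobiSolution.monodromy {r : ℕ} (hr : 0 < r) (ha : ∀ n, a (n + r) = a n)
    (hb : ∀ n, b (n + r) = b n) (hb0 : ∀ n, b n ≠ 0) (hx : IsJacobiSolution a b x) (n : ℕ) :
    x (n + r + r) + x n = naimanTilde r a b • x (n + r) := by
  have hy := hx.shift ha hb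
  have hyy := hy.shift ha hb
  -- Both sides solve the recurrence, so that only the first two indices have to be compared.
  suffices h : x (0 + r + r) + x 0 - naimanTilde r a b • x (0 + r) = 0 ∧
      x (1 + r + r) + x 1 - naimanTilde r a b • x (1 + r) = 0 by
    have hz : IsJacobiSolution a b fun n =>
        x (n + r + r) + x n - naimanTilde r a b • x (n + r) := by
      intro n
      linear_combination (norm := module) hyy n + hx n - naimanTilde r a b • hy n
    exact sub_eq_zero.1 (hz.eq_zero hb0 h.1 h.2 n)
  obtain ⟨s, rfl⟩ := Nat.exists_eq_add_of_lt hr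
  rw [zero_add] at *
  have hbr : b (s + 1 : ℕ) = b 0 := by simpa using hb 0
  have hsec : jacobiDelta a b 2 (((s + 1 : ℕ) : ℤ) - 1) = secondContinuant a b s := by
    simp [secondContinuant]
  have hm : jacobiModulus (s + 1) b = offDiagProd b (s + 1) := rfl
  have hT : C (offDiagProd b (s + 1)) * naimanTilde (s + 1) a b = (-1) ^ (s + 1) *
      (firstContinuant a b (s + 1) - C (b 0) ^ 2 * secondContinuant a b s) := by
    rw [naimanTilde, ← mul_assoc, ← C_mul, hm, mul_inv_cancel₀ (offDiagProd_ne_zero b hb0 _), C_1,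
      one_mul, naimanPoly, hsec, hbr, C_pow]
  have hW := continuant_wronskian a b s
  have hB : C (offDiagProd b (s + 1)) = C (offDiagProd b s) * C (b 0) := by
    rw [offDiagProd_succ, C_mul, hbr]
  have hsgn : ((-1 : ℂ[X]) ^ s) ^ 2 = 1 := by rw [← pow_mul, mul_comm, pow_mul]; simp
  have hx1 := hx.eq_continuants s
  have hx2 := hx.eq_continuants (s + 1)
  have hy1 := hy.eq_continuants s
  have hy2 := hy.eq_continuants (s + 1)
  have i2 : 1 + (s + 1) = s + 1 + 1 := by ring
  simp only [zero_add, i2] at hx1 hx2 hy1 hy2 ⊢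
  rw [pow_succ] at hx2 hy2 hT
  rw [hB] at hx2 hy2 hT
  have e1 : s + 1 + 1 + (s + 1) = s + 1 + (s + 1) + 1 := by ring
  have hcancel : ∀ w : M, (C (offDiagProd b s) ^ 2 * C (b 0)) • w = 0 → w = 0 := by
    intro w hw
    refine C_smul_cancel (c := offDiagProd b s ^ 2 * b 0)
      (mul_ne_zero (pow_ne_zero _ (offDiagProd_ne_zero b hb0 s)) (hb0 0)) ?_
    rw [C_mul, C_pow, hw, smul_zero]
  set B := C (offDiagProd b s)
  set c := C (b 0)
  set σ : ℂ[X] := (-1) ^ s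
  set p := firstContinuant a b s
  set p' := firstContinuant a b (s + 1)
  set q := secondContinuant a b s
  set q' := secondContinuant a b (s + 1)
  constructor <;> apply hcancel
  · linear_combination (norm := module) (B * c) • hy1 + (σ * p) • hx2 + (σ * p') • hx1 -
      hT • (B • x (s + 1)) + hW • ((σ ^ 2 * c) • x 0) - hsgn • ((c * B ^ 2) • x 0)
  · rw [e1] at *
    linear_combination (norm := module) B • hy2 - hT • (B • x (s + 1 + 1)) - (σ * c * q') • hx1 -
      (σ * c * q) • hx2 + hW • ((σ ^ 2 * c) • x 1) - hsgn • ((c * B ^ 2) • x 1)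

end Module

/-! ### The spectrum -/

/-- The unit vectors of `ℓ²(ℤ)`. -/
def unitVec (n : ℤ) : EllTwo := lp.single 2 n 1

theorem unitVec_apply (n m : ℤ) : unitVec n m = if m = n then 1 else 0 := by
  simp [unitVec, Pi.single_apply]

theorem shiftOp_apply (k : ℤ) (f : EllTwo) (n : ℤ) : shiftOp k f n = f (n + k) := rfl

theorem shiftOp_unitVec (k n : ℤ) : shiftOp k (unitVec n) = unitVec (n - k) := by
  ext m
  simp only [shiftOp_apply, unitVec_apply]
  congr 1
  exact propext ⟨fun h => by omega, fun h => by omega⟩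

theorem jacobiOp_unitVec (a b : EllInfty) (n : ℤ) :
    jacobiOp a b (unitVec n) =
      b (n - 1) • unitVec (n - 1) + a n • unitVec n + b n • unitVec (n + 1) := by
  ext m
  rw [jacobiOp_apply]
  simp only [lp.coeFn_add, lp.coeFn_smul, Pi.add_apply, Pi.smul_apply, unitVec_apply, smul_eq_mul]
  have h1 : (m - 1 = n) ↔ (m = n + 1) := by omega
  have h2 : (m + 1 = n) ↔ (m = n - 1) := by omega
  simp only [h1, h2]
  split_ifs <;> first | omega | (subst_vars; simp)

theorem norm_unitVec (n : ℤ) : ‖unitVec n‖ = 1 := by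
  rw [unitVec, lp.norm_single (by norm_num), norm_one]

instance : Nontrivial EllTwo :=
  ⟨unitVec 0, 0, norm_ne_zero_iff.1 (by rw [norm_unitVec]; exact one_ne_zero)⟩

instance : IsScalarTower ℂ (EllTwo →L[ℂ] EllTwo) EllTwo := ⟨fun _ _ _ => rfl⟩

theorem continuousLinearMap_ext_unitVec {S T : EllTwo →L[ℂ] EllTwo}
    (h : ∀ n, S (unitVec n) = T (unitVec n)) : S = T := by
  refine lp.ext_continuousLinearMap (by norm_num) fun n => ?_
  ext : 1
  exact h n

theorem shift_mul {u : ℤ → ℂ} {r : ℕ} (hu : ∀ n, u (n + r) = u n) (n k : ℤ) :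
    u (n + r * k) = u n := by
  have h : Function.Periodic u (r : ℤ) := hu
  have := h.int_mul k n
  rwa [mul_comm] at this

/-- The unit vectors solve the Jacobi recurrence with the operator itself as spectral parameter.
The Cayley–Hamilton relation of the monodromy matrix is therefore an identity between operators. -/
theorem aeval_jacobiOp_naimanTilde (r : ℕ) (hr : 0 < r) (a b : EllInfty)
    (ha : ∀ n : ℤ, a (n + r) = a n) (hb : ∀ n : ℤ, b (n + r) = b n) (hb0 : ∀ n : ℤ, b n ≠ 0) :
    aeval (jacobiOp a b) (naimanTilde r a b) = shiftOp r + shiftOp (-r) := by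
  refine continuousLinearMap_ext_unitVec fun m => ?_
  set J := jacobiOp a b
  set k : ℤ := m / r - 1
  have hx : IsJacobiSolution a b
      fun n : ℕ => Module.AEval.of ℂ EllTwo J (unitVec (n + r * k)) := by
    intro n
    rw [Module.AEval.X_smul_of, ContinuousLinearMap.smul_def, jacobiOp_unitVec,
      shift_mul (u := a) ha, show ((n + 1 : ℕ) : ℤ) + r * k - 1 = n + r * k by push_cast; ring,
      shift_mul (u := b) hb, shift_mul (u := b) hb,
      show ((n + 1 : ℕ) : ℤ) + r * k + 1 = (n + 2 : ℕ) + r * k by push_cast; ring]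
    simp only [Module.AEval.C_smul, map_add, map_smul]
  obtain ⟨j, hj⟩ := Int.eq_ofNat_of_zero_le (Int.emod_nonneg m (by omega : (r : ℤ) ≠ 0))
  have hm : m = j + r + r * k := by
    have := Int.emod_add_mul_ediv m r
    simp only [k]
    rw [← hj]; linarith
  have h := hx.monodromy hr ha hb hb0 j
  rw [← Module.AEval.of_aeval_smul, ← map_add] at h
  have h2 := (Module.AEval.of ℂ EllTwo J).injective h
  rw [ContinuousLinearMap.smul_def] at h2
  rw [add_apply, shiftOp_unitVec, shiftOp_unitVec]
  rw [show m = ((j + r : ℕ) : ℤ) + r * k by push_cast; exact hm, ← h2, add_comm]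
  congr 2 <;> · push_cast; ring

theorem isSelfAdjoint_shiftOp_add (k : ℤ) : IsSelfAdjoint (shiftOp k + shiftOp (-k)) := by
  have h (k : ℤ) (f g : EllTwo) : inner ℂ (shiftOp k f) g = inner ℂ f (shiftOp (-k) g) := by
    rw [lp.inner_eq_tsum, lp.inner_eq_tsum, ← (Equiv.addRight (-k)).tsum_eq]
    simp [shiftOp_apply]
  rw [ContinuousLinearMap.isSelfAdjoint_iff_isSymmetric]
  intro f g
  simp only [ContinuousLinearMap.coe_coe, add_apply, inner_add_left,
    inner_add_right, h, neg_neg]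
  exact add_comm _ _

theorem norm_shiftOp_le (k : ℤ) : ‖shiftOp k‖ ≤ 1 :=
  LinearMap.mkContinuous_norm_le _ zero_le_one _

/-- The preimage of the segment `[-2, 2]` under a polynomial. -/
def segmentPreimage (Q : ℂ[X]) : Set ℂ := {z | ∃ t ∈ Set.Icc (-2 : ℝ) 2, Q.eval z = t}

/-- The operator `shiftOp r + shiftOp (-r)` is self-adjoint of norm at most `2`, so its spectrum
lies in `[-2, 2]`; by the spectral mapping theorem `Q(z)` belongs to it for `z` in the spectrum
of the Jacobi operator. -/
theorem spectrum_jacobiOp_subset (r : ℕ) (hr : 0 < r) (a b : EllInfty)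
    (ha : ∀ n : ℤ, a (n + r) = a n) (hb : ∀ n : ℤ, b (n + r) = b n) (hb0 : ∀ n : ℤ, b n ≠ 0) :
    spectrum ℂ (jacobiOp a b) ⊆ segmentPreimage (naimanTilde r a b) := by
  intro z hz
  have h := spectrum.subset_polynomial_aeval (jacobiOp a b) (naimanTilde r a b) ⟨z, hz, rfl⟩
  rw [aeval_jacobiOp_naimanTilde r hr a b ha hb hb0] at h
  have hre := (isSelfAdjoint_shiftOp_add r).mem_spectrum_eq_re h
  have hn := spectrum.norm_le_norm_of_mem h
  have hn2 : ‖eval z (naimanTilde r a b)‖ ≤ 2 := by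
    refine hn.trans ((norm_add_le _ _).trans ?_)
    linarith [norm_shiftOp_le r, norm_shiftOp_le (-r)]
  exact ⟨_, abs_le.1 ((Complex.abs_re_le_norm _).trans hn2), hre⟩

/-- The solution of the scalar Jacobi recurrence on the half-line with initial values `0, 1`. -/
def halfLineSolution (a b : ℤ → ℂ) (z : ℂ) : ℕ → ℂ
  | 0 => 0
  | 1 => 1
  | n + 2 => ((z - a (n + 1 : ℕ)) * halfLineSolution a b z (n + 1) -
      b n * halfLineSolution a b z n) / b (n + 1 : ℕ)

theorem halfLineSolution_recurrence (a b : ℤ → ℂ) (hb0 : ∀ n, b n ≠ 0) (z : ℂ) (n : ℕ) :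
    b n * halfLineSolution a b z n + a (n + 1 : ℕ) * halfLineSolution a b z (n + 1) +
      b (n + 1 : ℕ) * halfLineSolution a b z (n + 2) = z * halfLineSolution a b z (n + 1) := by
  rw [halfLineSolution.eq_3, mul_div_cancel₀ _ (hb0 _)]
  ring

/-- The Cayley–Hamilton relation of the monodromy matrix for complex solutions with spectral
parameter `z`. -/
theorem scalar_monodromy {r : ℕ} (hr : 0 < r) {a b : ℤ → ℂ} (ha : ∀ n, a (n + r) = a n)
    (hb : ∀ n, b (n + r) = b n) (hb0 : ∀ n, b n ≠ 0) (z : ℂ) (f : ℕ → ℂ)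
    (hf : ∀ n : ℕ, b n * f n + a (n + 1 : ℕ) * f (n + 1) + b (n + 1 : ℕ) * f (n + 2) =
      z * f (n + 1)) (n : ℕ) :
    f (n + r + r) + f n = (naimanTilde r a b).eval z * f (n + r) := by
  have hx : IsJacobiSolution a b fun n : ℕ => Module.AEval.of ℂ ℂ z (f n) := by
    intro n
    rw [Module.AEval.X_smul_of, smul_eq_mul, ← hf n]
    simp only [Module.AEval.C_smul, map_add, ← smul_eq_mul, map_smul]
  have h := hx.monodromy hr ha hb hb0 n
  rw [← Module.AEval.of_aeval_smul, ← map_add] at h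
  have h2 := (Module.AEval.of ℂ ℂ z).injective h
  rw [h2, coe_aeval_eq_eval, smul_eq_mul]

/-- If the normalized Naiman polynomial takes a value `h + h⁻¹` with `|h| = 1`, then there is a
nonzero solution whose modulus is periodic: a solution `f` with multiplier `h⁻¹`, or else
`n ↦ f (n + r) - h⁻¹ f n`, which has multiplier `h`. -/
theorem exists_norm_periodic_solution {r : ℕ} (hr : 0 < r) {a b : ℤ → ℂ}
    (ha : ∀ n, a (n + r) = a n) (hb : ∀ n, b (n + r) = b n) (hb0 : ∀ n, b n ≠ 0) (z h : ℂ)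
    (hh : ‖h‖ = 1) (hQ : (naimanTilde r a b).eval z = h + h⁻¹) :
    ∃ f : ℕ → ℂ, (∀ n : ℕ, b n * f n + a (n + 1 : ℕ) * f (n + 1) + b (n + 1 : ℕ) * f (n + 2) =
      z * f (n + 1)) ∧ (∀ n, ‖f (n + r)‖ = ‖f n‖) ∧ ∃ n, f n ≠ 0 := by
  have hne : h ≠ 0 := norm_ne_zero_iff.1 (by rw [hh]; exact one_ne_zero)
  set f := halfLineSolution a b z with hfdef
  have hf := halfLineSolution_recurrence a b hb0 z
  have hmon := scalar_monodromy hr ha hb hb0 z f hf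
  rw [hQ] at hmon
  by_cases hg : ∀ n, f (n + r) - h⁻¹ * f n = 0
  · refine ⟨f, hf, fun n => ?_, 1, by simp [hfdef, halfLineSolution]⟩
    rw [sub_eq_zero.1 (hg n), norm_mul, norm_inv, hh, inv_one, one_mul]
  · push Not at hg
    refine ⟨fun n => f (n + r) - h⁻¹ * f n, fun n => ?_, fun n => ?_, hg⟩
    · have h1 := hf n
      have h2 := hf (n + r)
      have e : ((n + r + 1 : ℕ) : ℤ) = (n + 1 : ℕ) + r := by push_cast; ring
      rw [e, ha, hb, Nat.cast_add, hb] at h2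
      rw [show n + r + 1 = n + 1 + r by omega, show n + r + 2 = n + 2 + r by omega] at h2
      linear_combination h2 - h⁻¹ * h1
    · have : f (n + r + r) - h⁻¹ * f (n + r) = h * (f (n + r) - h⁻¹ * f n) := by
        rw [mul_sub, mul_inv_cancel_left₀ hne]
        linear_combination hmon n
      simp only [this, norm_mul, hh, one_mul]

/-- The truncation of a solution is mapped to boundary terms. -/
theorem jacobiOp_sub_truncation (a b : EllInfty) (z : ℂ) (f : ℕ → ℂ)
    (hf : ∀ n : ℕ, b n * f n + a (n + 1 : ℕ) * f (n + 1) + b (n + 1 : ℕ) * f (n + 2) =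
      z * f (n + 1)) (N : ℕ) :
    (jacobiOp a b - z • 1) (∑ n ∈ Finset.range N, f (n + 1) • unitVec (n + 1 : ℕ)) =
      (b 0 * f 1) • unitVec 0 - (b 0 * f 0) • unitVec 1 - (b N * f (N + 1)) • unitVec N +
        (b N * f N) • unitVec (N + 1 : ℕ) := by
  induction N with
  | zero => simp
  | succ N ih =>
    rw [Finset.sum_range_succ, map_add, ih, map_smul]
    simp only [sub_apply, smul_apply,
      one_apply_eq_self]
    rw [jacobiOp_unitVec, show ((N + 1 : ℕ) : ℤ) - 1 = N by push_cast; ring,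
      show ((N + 1 : ℕ) : ℤ) + 1 = (N + 1 + 1 : ℕ) by push_cast; ring]
    linear_combination (norm := module) hf N • unitVec (N + 1 : ℕ)

/-- The truncations of a solution of periodic modulus have unbounded norm, whereas their images are
boundary terms of bounded norm. A bounded left inverse is therefore impossible. -/
theorem not_isUnit_jacobiOp_sub {r : ℕ} (hr : 0 < r) (a b : EllInfty) (z : ℂ) (f : ℕ → ℂ)
    (hf : ∀ n : ℕ, b n * f n + a (n + 1 : ℕ) * f (n + 1) + b (n + 1 : ℕ) * f (n + 2) =
      z * f (n + 1)) (hper : ∀ n, ‖f (n + r)‖ = ‖f n‖) (hne : ∃ n, f n ≠ 0) :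
    ¬ IsUnit (jacobiOp a b - z • 1) := by
  intro hu
  obtain ⟨S, hS⟩ := hu.exists_left_inv
  have hmul (n k : ℕ) : ‖f (n + r * k)‖ = ‖f n‖ := by
    have h : Function.Periodic (fun n => ‖f n‖) r := hper
    have := h.nat_mul k n
    rwa [mul_comm] at this
  obtain ⟨F, hF⟩ : ∃ F, ∀ n, ‖f n‖ ≤ F := by
    refine ⟨∑ i ∈ Finset.range r, ‖f i‖, fun n => ?_⟩
    rw [← Nat.mod_add_div n r, hmul]
    exact Finset.single_le_sum (f := fun i => ‖f i‖) (fun _ _ => norm_nonneg _)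
      (Finset.mem_range.2 (Nat.mod_lt _ hr))
  have hB (n : ℤ) (m : ℕ) (k : ℤ) : ‖(b n * f m) • unitVec k‖ ≤ ‖b‖ * F := by
    rw [norm_smul, norm_unitVec, mul_one, norm_mul]
    exact mul_le_mul (lp.norm_apply_le_norm ENNReal.top_ne_zero b n) (hF m) (norm_nonneg _)
      (norm_nonneg _)
  -- a left inverse bounds the norm of the truncations by that of the boundary terms
  have hbound (N : ℕ) : ∑ n ∈ Finset.range N, ‖f (n + 1)‖ ^ 2 ≤ (‖S‖ * (4 * (‖b‖ * F))) ^ 2 := by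
    set v := ∑ n ∈ Finset.range N, f (n + 1) • unitVec (n + 1 : ℕ) with hv
    have h1 : ‖v‖ ≤ ‖S‖ * (4 * (‖b‖ * F)) := by
      have h2 : v = S ((jacobiOp a b - z • 1) v) := by
        rw [← mul_apply_eq_comp, hS, one_apply_eq_self]
      rw [h2, hv, jacobiOp_sub_truncation a b z f hf N]
      refine (S.le_opNorm _).trans (mul_le_mul_of_nonneg_left ?_ (norm_nonneg _))
      refine (norm_add_le _ _).trans ?_
      refine (add_le_add (norm_sub_le _ _) le_rfl).trans ?_
      refine (add_le_add (add_le_add (norm_sub_le _ _) le_rfl) le_rfl).trans ?_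
      linarith [hB 0 1 0, hB 0 0 1, hB N (N + 1) N, hB N N (N + 1 : ℕ)]
    have h3 : ∑ n ∈ Finset.range N, ‖f (n + 1)‖ ^ 2 = ‖v‖ ^ 2 := by
      have h4 := lp.norm_sum_single (p := 2) (E := fun _ : ℤ => ℂ) (by norm_num)
        (fun k => f k.toNat) ((Finset.range N).map ((addRightEmbedding 1).trans Nat.castEmbedding))
      have h5 : ∀ n : ℕ, lp.single (E := fun _ : ℤ => ℂ) 2 (n : ℤ) (f n) = f n • unitVec n := by
        intro n
        rw [unitVec, ← lp.single_smul, smul_eq_mul, mul_one]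
      rw [Finset.sum_map, Finset.sum_map] at h4
      simp only [Function.Embedding.trans_apply, addRightEmbedding_apply, Nat.castEmbedding_apply,
        Int.toNat_natCast, h5] at h4
      rw [← hv] at h4
      simpa using h4.symm
    rw [h3]
    exact pow_le_pow_left₀ (norm_nonneg _) h1 2
  -- square-summability contradicts the periodicity of the modulus
  have hsum : Summable fun n => ‖f (n + 1)‖ ^ 2 :=
    summable_of_sum_range_le (fun _ => by positivity) hbound
  obtain ⟨n₀, hn₀⟩ := hne
  have hlim : Tendsto (fun k : ℕ => n₀ + r * (k + 1) - 1) atTop atTop := by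
    refine tendsto_atTop_mono (fun k => ?_) tendsto_id
    have : k + 1 ≤ r * (k + 1) := Nat.le_mul_of_pos_left _ hr
    simp only [id]; omega
  have h0 := hsum.tendsto_atTop_zero.comp hlim
  have hconst : ∀ k : ℕ, ‖f (n₀ + r * (k + 1) - 1 + 1)‖ ^ 2 = ‖f n₀‖ ^ 2 := by
    intro k
    have : k + 1 ≤ r * (k + 1) := Nat.le_mul_of_pos_left _ hr
    rw [Nat.sub_add_cancel (by omega), hmul]
  simp only [Function.comp_def, hconst] at h0
  have := tendsto_nhds_unique h0 tendsto_const_nhds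
  exact hn₀ (by simpa using this.symm)

/-- The spectrum of a periodic Jacobi operator is the preimage of `[-2, 2]` under the normalized
Naiman polynomial. -/
theorem spectrum_jacobiOp (r : ℕ) (hr : 0 < r) (a b : EllInfty)
    (ha : ∀ n : ℤ, a (n + r) = a n) (hb : ∀ n : ℤ, b (n + r) = b n) (hb0 : ∀ n : ℤ, b n ≠ 0) :
    spectrum ℂ (jacobiOp a b) = segmentPreimage (naimanTilde r a b) := by
  refine (spectrum_jacobiOp_subset r hr a b ha hb hb0).antisymm ?_
  rintro z ⟨t, ht, hz⟩
  set h : ℂ := Complex.exp (Real.arccos (t / 2) * Complex.I)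
  have hh : ‖h‖ = 1 := Complex.norm_exp_ofReal_mul_I _
  have hQ : (naimanTilde r a b).eval z = h + h⁻¹ := by
    have h1 : h + h⁻¹ = 2 * Complex.cos (Real.arccos (t / 2)) := by
      rw [Complex.two_cos, ← Complex.exp_neg, neg_mul]
    rw [hz, h1, ← Complex.ofReal_cos, Real.cos_arccos (by linarith [ht.1]) (by linarith [ht.2])]
    push_cast; ring
  obtain ⟨f, hf, hper, hne⟩ := exists_norm_periodic_solution hr ha hb hb0 z h hh hQ
  have hnu := not_isUnit_jacobiOp_sub hr a b z f hf hper hne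
  rw [spectrum.mem_iff, Algebra.algebraMap_eq_smul_one, IsUnit.sub_iff]
  exact hnu

/-! ### Fibre sums and extremality -/

/-- Power sums of degree at most `m` are determined by the elementary symmetric functions of
degree at most `m` (Newton's identities). -/
theorem sum_pow_eq_of_esymm_eq {σ : Type*} [Fintype σ] (f g : σ → ℂ) (m : ℕ)
    (h : ∀ k ≤ m, MvPolynomial.aeval f (MvPolynomial.esymm σ ℂ k) =
      MvPolynomial.aeval g (MvPolynomial.esymm σ ℂ k)) (k : ℕ) (hk : k ≤ m) :
    ∑ i, f i ^ k = ∑ i, g i ^ k := by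
  have hps (f : σ → ℂ) (k : ℕ) :
      MvPolynomial.aeval f (MvPolynomial.psum σ ℂ k) = ∑ i, f i ^ k := by
    simp [MvPolynomial.psum]
  rw [← hps, ← hps]
  induction k using Nat.strong_induction_on with
  | _ k ih =>
    rcases Nat.eq_zero_or_pos k with rfl | hk0
    · simp
    rw [MvPolynomial.psum_eq_mul_esymm_sub_sum σ ℂ k hk0]
    simp only [map_sub, map_mul, map_sum, map_pow, map_neg, map_one, map_natCast]
    rw [h k hk]
    congr 1
    refine Finset.sum_congr rfl fun a ha => ?_
    have hsum := Finset.HasAntidiagonal.mem_antidiagonal.1 (Finset.mem_filter.1 ha).1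
    have hpos := (Finset.mem_filter.1 ha).2.1
    rw [h a.1 (by omega), ih a.2 (by omega) (by omega)]

theorem Multiset.exists_eq_map_univ_fin {α : Type*} (s : Multiset α) {n : ℕ} (hs : s.card = n) :
    ∃ f : Fin n → α, s = Finset.univ.val.map f := by
  subst hs
  refine ⟨fun i => s.toList.get (i.cast s.length_toList.symm), ?_⟩
  rw [Fin.univ_val_map]
  conv_lhs => rw [← s.coe_toList]
  refine congrArg _ (List.ext_get (by simp) fun n h1 h2 => by simp)

section RootSum

variable {Q : ℂ[X]}

theorem sub_C_ne_zero (hQ : 0 < Q.natDegree) (w : ℂ) : Q - C w ≠ 0 := by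
  intro h
  have := natDegree_sub_C (p := Q) (a := w)
  rw [h, natDegree_zero] at this
  omega

theorem leadingCoeff_sub_C (hQ : 0 < Q.natDegree) (w : ℂ) :
    (Q - C w).leadingCoeff = Q.leadingCoeff := by
  rw [leadingCoeff, natDegree_sub_C, coeff_sub, coeff_C_of_ne_zero hQ.ne', sub_zero, leadingCoeff]

theorem card_roots_sub_C (w : ℂ) : (Q - C w).roots.card = Q.natDegree := by
  rw [splits_iff_card_roots.1 (IsAlgClosed.splits _), natDegree_sub_C]

theorem mem_roots_sub_C (hQ : 0 < Q.natDegree) {w z : ℂ} :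
    z ∈ (Q - C w).roots ↔ Q.eval z = w := by
  rw [mem_roots (sub_C_ne_zero hQ w), IsRoot, eval_sub, eval_C, sub_eq_zero]

/-- The sum of a function over the fibre of `Q` above `w`, with multiplicity. -/
def fibreSum {M : Type*} [AddCommMonoid M] (Q : ℂ[X]) (f : ℂ → M) (w : ℂ) : M :=
  ((Q - C w).roots.map f).sum

/-- The sum of the values of `q` over the fibre of `Q` above `w`, with multiplicity. -/
def rootSum (Q q : ℂ[X]) (w : ℂ) : ℂ := fibreSum Q (fun z => q.eval z) w

theorem rootSum_add (p q : ℂ[X]) (w : ℂ) : rootSum Q (p + q) w = rootSum Q p w + rootSum Q q w := by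
  simp [rootSum, fibreSum, Multiset.sum_map_add]

theorem rootSum_C_mul (c : ℂ) (q : ℂ[X]) (w : ℂ) : rootSum Q (C c * q) w = c * rootSum Q q w := by
  simp [rootSum, fibreSum, Multiset.sum_map_mul_left]

theorem rootSum_mul_self (hQ : 0 < Q.natDegree) (q : ℂ[X]) (w : ℂ) :
    rootSum Q (Q * q) w = w * rootSum Q q w := by
  rw [rootSum, rootSum, fibreSum, fibreSum, ← Multiset.sum_map_mul_left]
  refine congrArg _ (Multiset.map_congr rfl fun z hz => ?_)
  rw [eval_mul, (mem_roots_sub_C hQ).1 hz]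

theorem rootSum_one (w : ℂ) : rootSum Q 1 w = Q.natDegree := by
  simp [rootSum, fibreSum, card_roots_sub_C]

/-- The coefficients of `Q - w` other than the constant one do not depend on `w`, hence neither do
the power sums of degree less than `deg Q` of its roots. -/
theorem rootSum_X_pow (hQ : 0 < Q.natDegree) {k : ℕ} (hk : k < Q.natDegree) (w : ℂ) :
    rootSum Q (X ^ k) w = rootSum Q (X ^ k) 0 := by
  obtain ⟨f, hf⟩ := (Q - C w).roots.exists_eq_map_univ_fin (card_roots_sub_C w)
  obtain ⟨g, hg⟩ := (Q - C 0).roots.exists_eq_map_univ_fin (card_roots_sub_C 0)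
  have hes : ∀ j ≤ k, (Q - C w).roots.esymm j = (Q - C 0).roots.esymm j := by
    intro j hj
    have hle : Q.natDegree - j ≤ Q.natDegree := Nat.sub_le _ _
    have h1 := coeff_eq_esymm_roots_of_splits (IsAlgClosed.splits (Q - C w))
      (k := Q.natDegree - j) (by rw [natDegree_sub_C]; exact hle)
    have h2 := coeff_eq_esymm_roots_of_splits (IsAlgClosed.splits (Q - C 0))
      (k := Q.natDegree - j) (by rw [natDegree_sub_C]; exact hle)
    rw [leadingCoeff_sub_C hQ, natDegree_sub_C, coeff_sub, coeff_C_of_ne_zero (by omega),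
      Nat.sub_sub_self (by omega)] at h1 h2
    rw [h1] at h2
    refine mul_left_cancel₀ (mul_ne_zero (leadingCoeff_ne_zero.2 (ne_zero_of_natDegree_gt hQ))
      (pow_ne_zero j (neg_ne_zero.2 one_ne_zero))) h2
  simp only [rootSum, fibreSum, eval_pow, eval_X]
  rw [hf, hg, Multiset.map_map, Multiset.map_map]
  refine sum_pow_eq_of_esymm_eq f g k (fun j hj => ?_) k le_rfl
  rw [MvPolynomial.aeval_esymm_eq_multiset_esymm, MvPolynomial.aeval_esymm_eq_multiset_esymm,
    ← hf, ← hg, hes j hj]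

theorem rootSum_eq_of_natDegree_lt (hQ : 0 < Q.natDegree) {q : ℂ[X]}
    (hq : q.natDegree < Q.natDegree) (w : ℂ) : rootSum Q q w = rootSum Q q 0 := by
  have h (w : ℂ) : rootSum Q q w =
      ∑ k ∈ Finset.range Q.natDegree, q.coeff k * rootSum Q (X ^ k) w := by
    have hs (s : Finset ℕ) : rootSum Q (∑ k ∈ s, C (q.coeff k) * X ^ k) w =
        ∑ k ∈ s, q.coeff k * rootSum Q (X ^ k) w := by
      induction s using Finset.induction_on with
      | empty => simp [rootSum, fibreSum]
      | insert k s hk ih =>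
        rw [Finset.sum_insert hk, Finset.sum_insert hk, rootSum_add, rootSum_C_mul, ih]
    rw [← hs, ← q.as_sum_range_C_mul_X_pow' hq]
  rw [h, h]
  exact Finset.sum_congr rfl fun k hk => by rw [rootSum_X_pow hQ (Finset.mem_range.1 hk)]

/-- The fibre sum of a polynomial of degree less than `m * deg Q` is a polynomial of degree less
than `m` in the base point. -/
theorem exists_rootSum_eq_eval (hQ : 0 < Q.natDegree) (m : ℕ) (q : ℂ[X])
    (hq : q.degree < (m * Q.natDegree : ℕ)) :
    ∃ R : ℂ[X], R.degree < m ∧ ∀ w, rootSum Q q w = R.eval w := by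
  induction m generalizing q with
  | zero =>
    refine ⟨0, by simp, fun w => ?_⟩
    have : q = 0 := by simpa using hq
    simp [rootSum, fibreSum, this]
  | succ m ih =>
    have hQ0 : Q ≠ 0 := ne_zero_of_natDegree_gt hQ
    have hmod : (q % Q).natDegree < Q.natDegree := natDegree_mod_lt q hQ.ne'
    have hdiv : (q / Q).degree < (m * Q.natDegree : ℕ) := by
      by_cases h0 : q / Q = 0
      · rw [h0, degree_zero]; exact WithBot.bot_lt_coe _
      have hq0 : q ≠ 0 := by rintro rfl; simp at h0
      have hle : Q.degree ≤ q.degree := by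
        by_contra hlt
        exact h0 (Polynomial.div_eq_zero_iff hQ0 |>.2 (not_le.1 hlt))
      have h := degree_add_div hQ0 hle
      rw [degree_eq_natDegree hQ0, degree_eq_natDegree h0, degree_eq_natDegree hq0] at h
      rw [← natDegree_lt_iff_degree_lt hq0, Nat.succ_mul] at hq
      rw [← natDegree_lt_iff_degree_lt h0]
      have : Q.natDegree + (q / Q).natDegree = q.natDegree := by exact_mod_cast h
      omega
    obtain ⟨R, hR, hRe⟩ := ih _ hdiv
    refine ⟨X * R + C (rootSum Q (q % Q) 0), ?_, fun w => ?_⟩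
    · refine (degree_add_le _ _).trans_lt (max_lt ?_ ?_)
      · by_cases hR0 : R = 0
        · simp [hR0]
        · rw [← natDegree_lt_iff_degree_lt hR0] at hR
          rw [← natDegree_lt_iff_degree_lt (mul_ne_zero X_ne_zero hR0), natDegree_X_mul hR0]
          omega
      · exact degree_C_le.trans_lt (by exact_mod_cast Nat.succ_pos m)
    · conv_lhs => rw [← EuclideanDomain.div_add_mod q Q]
      rw [rootSum_add, rootSum_mul_self hQ, hRe, rootSum_eq_of_natDegree_lt hQ hmod]
      simp

end RootSum

/-- A complex polynomial of degree at most `n` that is bounded by `M` on `[-2, 2]` has its `n`-th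
coefficient bounded by `M / 2`. -/
theorem two_mul_norm_coeff_le {n : ℕ} (hn : 1 ≤ n) (R : ℂ[X]) (hR : R.natDegree ≤ n) {M : ℝ}
    (hM : ∀ x ∈ Set.Icc (-2 : ℝ) 2, ‖R.eval (x : ℂ)‖ ≤ M) : 2 * ‖R.coeff n‖ ≤ M := by
  refine le_of_forall_gt_imp_ge_of_dense fun M' hM' => ?_
  have hM0 : 0 < M' := ((norm_nonneg _).trans (hM 0 (by norm_num))).trans_lt hM'
  obtain ⟨u, hu, huc⟩ := Complex.exists_norm_eq_mul_self (R.coeff n)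
  -- the real part of the rotated polynomial, rescaled to `[-1, 1]`
  set S : ℝ[X] := ∑ k ∈ Finset.range (n + 1), C ((u * R.coeff k).re * 2 ^ k / M') * X ^ k with hS
  have heval (x : ℝ) : S.eval x = (u * R.eval ((2 * x : ℝ) : ℂ)).re / M' := by
    rw [eval_eq_sum_range' (Nat.lt_succ_of_le hR), Finset.mul_sum, Complex.re_sum,
      Finset.sum_div, hS, eval_finsetSum]
    refine Finset.sum_congr rfl fun k _ => ?_
    rw [← mul_assoc, ← Complex.ofReal_pow, Complex.re_mul_ofReal, mul_pow]
    simp only [eval_mul, eval_C, eval_pow, eval_X]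
    ring
  have hdeg : S.degree ≤ n := by
    refine (degree_sum_le _ _).trans (Finset.sup_le fun k hk => ?_)
    refine (degree_C_mul_X_pow_le _ _).trans ?_
    exact_mod_cast Nat.lt_succ_iff.1 (Finset.mem_range.1 hk)
  have hbnd : ∀ x ∈ Set.Icc (-1 : ℝ) 1, |S.eval x| ≤ 1 := by
    intro x hx
    rw [heval, abs_div, abs_of_pos hM0, div_le_one hM0]
    refine (Complex.abs_re_le_norm _).trans ?_
    rw [norm_mul, hu, one_mul]
    exact (hM _ ⟨by linarith [hx.1], by linarith [hx.2]⟩).trans hM'.le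
  have h := Polynomial.Chebyshev.coeff_le_of_forall_abs_le_one hdeg hbnd
  have hco : S.coeff n = ‖R.coeff n‖ * 2 ^ n / M' := by
    rw [hS, finsetSum_coeff, Finset.sum_eq_single n]
    · rw [coeff_C_mul_X_pow, if_pos rfl, ← huc, Complex.ofReal_re]
    · intro k _ hk
      rw [coeff_C_mul_X_pow, if_neg (Ne.symm hk)]
    · simp
  rw [hco, div_le_iff₀ hM0] at h
  obtain ⟨m, rfl⟩ := Nat.exists_eq_add_of_le' hn
  rw [Nat.add_sub_cancel, pow_succ] at h
  have h2 : (0 : ℝ) < 2 ^ m := by positivity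
  nlinarith

/-- The assumption `1 ≤ n` excludes the constant polynomial `2`, which is not monic. -/
theorem monic_natDegree_chebyshev_C {n : ℕ} (hn : 1 ≤ n) :
    (Chebyshev.C ℂ (n : ℤ)).Monic ∧ (Chebyshev.C ℂ (n : ℤ)).natDegree = n := by
  have : Invertible (2 : ℂ) := invertibleOfNonzero two_ne_zero
  have h1 : (C (⅟2 : ℂ) * X).natDegree = 1 := natDegree_C_mul_X _ (by simp)
  have h2 : ((2 : ℂ[X])) = C 2 := rfl
  rw [Chebyshev.C_eq_two_mul_T_comp_half_mul_X, h2]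
  constructor
  · rw [Monic, leadingCoeff_mul, leadingCoeff_C, leadingCoeff_comp (by rw [h1]; exact one_ne_zero),
      Chebyshev.leadingCoeff_T, Chebyshev.natDegree_T, leadingCoeff_C_mul_X]
    obtain ⟨m, rfl⟩ := Nat.exists_eq_add_of_le' hn
    simp only [Int.natAbs_natCast, Nat.add_sub_cancel, invOf_eq_inv]
    rw [← mul_assoc, ← pow_succ', ← mul_pow, mul_inv_cancel₀ two_ne_zero, one_pow]
  · rw [natDegree_C_mul two_ne_zero, natDegree_comp, h1, Chebyshev.natDegree_T]
    simp

/-- The least sup-norm on the preimage of `[-2, 2]` under `Q` of the monic polynomials of degree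
`n * deg Q` is at least `2 |lead Q|⁻ⁿ`. -/
theorem le_norm_of_monic_on_segmentPreimage {Q : ℂ[X]} (hQ : 0 < Q.natDegree) {n : ℕ} (hn : 1 ≤ n)
    {q : ℂ[X]} (hq : q.Monic) (hqd : q.natDegree = n * Q.natDegree) {M : ℝ}
    (hM : ∀ z ∈ segmentPreimage Q, ‖q.eval z‖ ≤ M) : 2 * (‖Q.leadingCoeff‖ ^ n)⁻¹ ≤ M := by
  set c := Q.leadingCoeff with hc
  have hc0 : c ≠ 0 := leadingCoeff_ne_zero.2 (ne_zero_of_natDegree_gt hQ)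
  -- `q₁` is the part of `q` of degree less than `n * deg Q`; it does not contribute to the top
  -- coefficient of the fibre sum
  set q₁ := q - C (c ^ n)⁻¹ * Q ^ n with hq₁
  have hlead : (C (c ^ n)⁻¹ * Q ^ n).leadingCoeff = 1 := by
    rw [leadingCoeff_mul, leadingCoeff_C, leadingCoeff_pow, inv_mul_cancel₀ (pow_ne_zero _ hc0)]
  have hdegQ : (C (c ^ n)⁻¹ * Q ^ n).natDegree = n * Q.natDegree := by
    rw [natDegree_C_mul (inv_ne_zero (pow_ne_zero _ hc0)), natDegree_pow]
  have hq₁d : q₁.degree < (n * Q.natDegree : ℕ) := by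
    rw [← hqd, ← degree_eq_natDegree hq.ne_zero]
    refine degree_sub_lt_left ?_ hq.ne_zero (by rw [hlead, hq.leadingCoeff])
    rw [degree_eq_natDegree hq.ne_zero, hqd, ← hdegQ, degree_eq_natDegree]
    rw [← leadingCoeff_ne_zero, hlead]
    exact one_ne_zero
  obtain ⟨R, hR, hRe⟩ := exists_rootSum_eq_eval hQ n q₁ hq₁d
  have hpow (w : ℂ) (k : ℕ) : rootSum Q (Q ^ k) w = w ^ k * Q.natDegree := by
    induction k with
    | zero => simp [rootSum_one]
    | succ k ih => rw [pow_succ', rootSum_mul_self hQ, ih]; ring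
  set R' : ℂ[X] := C ((c ^ n)⁻¹ * Q.natDegree) * X ^ n + R with hR'
  have hRe' (w : ℂ) : rootSum Q q w = R'.eval w := by
    have : q = C (c ^ n)⁻¹ * Q ^ n + q₁ := by rw [hq₁]; ring
    rw [this, rootSum_add, rootSum_C_mul, hpow, hRe]
    simp [hR']; ring
  have hco : R'.coeff n = (c ^ n)⁻¹ * Q.natDegree := by
    rw [hR', coeff_add, coeff_eq_zero_of_degree_lt hR, coeff_C_mul_X_pow, if_pos rfl, add_zero]
  have hdeg : R'.natDegree ≤ n :=
    natDegree_add_le_of_degree_le (natDegree_C_mul_X_pow_le _ _)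
      (natDegree_le_of_degree_le hR.le)
  have hbound : ∀ x ∈ Set.Icc (-2 : ℝ) 2, ‖R'.eval (x : ℂ)‖ ≤ Q.natDegree * M := by
    intro x hx
    rw [← hRe', rootSum, fibreSum]
    refine (norm_multiset_sum_le _).trans ?_
    rw [Multiset.map_map, ← card_roots_sub_C (Q := Q) (x : ℂ), ← nsmul_eq_mul]
    have := Multiset.sum_le_card_nsmul
      (((Q - C (x : ℂ)).roots.map (norm ∘ fun z => q.eval z))) M (by
        intro y hy
        obtain ⟨z, hz, rfl⟩ := Multiset.mem_map.1 hy
        exact hM z ⟨x, hx, (mem_roots_sub_C hQ).1 hz⟩)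
    rwa [Multiset.card_map] at this
  have h := two_mul_norm_coeff_le hn R' hdeg hbound
  rw [hco, norm_mul, norm_inv, norm_pow, Complex.norm_natCast] at h
  have hr : (0 : ℝ) < Q.natDegree := by exact_mod_cast hQ
  rw [← mul_assoc, mul_comm _ (Q.natDegree : ℝ)] at h
  exact le_of_mul_le_mul_left h hr

/-- The composition of the Chebyshev polynomial of `[-2, 2]` with `Q`, made monic, is a Chebyshev
polynomial of the preimage of `[-2, 2]` under `Q`. -/
theorem isChebyshevPolynomial_comp {Q : ℂ[X]} (hQ : 0 < Q.natDegree) {n : ℕ} (hn : 1 ≤ n) :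
    IsChebyshevPolynomial (segmentPreimage Q) (n * Q.natDegree)
      (C (Q.leadingCoeff ^ n)⁻¹ * (Chebyshev.C ℂ (n : ℤ)).comp Q) := by
  obtain ⟨hm, hd⟩ := monic_natDegree_chebyshev_C hn
  have hc0 : Q.leadingCoeff ≠ 0 := leadingCoeff_ne_zero.2 (ne_zero_of_natDegree_gt hQ)
  refine ⟨?_, ?_, fun q hq hqd => ?_⟩
  · rw [Monic, leadingCoeff_mul, leadingCoeff_C, leadingCoeff_comp hQ.ne', hm.leadingCoeff, hd,
      one_mul, inv_mul_cancel₀ (pow_ne_zero _ hc0)]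
  · rw [natDegree_C_mul (inv_ne_zero (pow_ne_zero _ hc0)), natDegree_comp, hd]
  · have hupper : (⨆ z ∈ segmentPreimage Q,
        ‖(C (Q.leadingCoeff ^ n)⁻¹ * (Chebyshev.C ℂ (n : ℤ)).comp Q).eval z‖ₑ) ≤
        ENNReal.ofReal (2 * (‖Q.leadingCoeff‖ ^ n)⁻¹) := by
      refine iSup₂_le fun z ⟨t, ht, hz⟩ => ?_
      rw [← ofReal_norm]
      refine ENNReal.ofReal_le_ofReal ?_
      have ht2 : t = 2 * Real.cos (Real.arccos (t / 2)) := by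
        rw [Real.cos_arccos (by linarith [ht.1]) (by linarith [ht.2])]; ring
      rw [eval_mul, eval_C, eval_comp, hz, ht2, ← Chebyshev.complex_ofReal_eval_C,
        Chebyshev.C_two_mul_real_cos, norm_mul, norm_inv, norm_pow, mul_comm]
      refine mul_le_mul_of_nonneg_right ?_ (by positivity)
      rw [Complex.norm_real, norm_mul, Real.norm_eq_abs, Real.norm_eq_abs]
      have := Real.abs_cos_le_one (((n : ℤ) : ℝ) * Real.arccos (t / 2))
      rw [abs_two]
      linarith
    refine hupper.trans ?_
    by_cases htop : (⨆ z ∈ segmentPreimage Q, ‖q.eval z‖ₑ) = ⊤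
    · rw [htop]; exact le_top
    rw [← ENNReal.ofReal_toReal htop]
    refine ENNReal.ofReal_le_ofReal (le_norm_of_monic_on_segmentPreimage hQ hn hq hqd ?_)
    intro z hz
    rw [← toReal_enorm]
    exact ENNReal.toReal_mono htop (le_iSup₂ (f := fun z _ => ‖q.eval z‖ₑ) z hz)

/-! ### Strict positive definiteness of the Gaussian kernel -/

section Gaussian

variable {E : Type*} [NormedAddCommGroup E] [MeasurableSpace E]

/-- The mutual energy of two measures for the Gaussian kernel `exp (-t ‖x - y‖²)`. -/
def gaussEnergy (t : ℝ) (ν μ : Measure E) : ℝ :=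
  ∫ p, Real.exp (-t * ‖p.1 - p.2‖ ^ 2) ∂(ν.prod μ)

theorem gaussEnergy_comm (t : ℝ) (ν μ : Measure E) [SFinite ν] [SFinite μ] :
    gaussEnergy t ν μ = gaussEnergy t μ ν := by
  rw [gaussEnergy, ← integral_prod_swap]
  simp only [Prod.fst_swap, Prod.snd_swap, norm_sub_rev]
  rfl

variable [InnerProductSpace ℝ E] [BorelSpace E]

theorem continuous_charFun [SecondCountableTopology E] (ν : Measure E) [IsFiniteMeasure ν] :
    Continuous (charFun ν) := by
  have h : charFun ν = fun t => ∫ x, Complex.exp (inner ℝ x t * Complex.I) ∂ν :=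
    funext fun t => charFun_apply t
  rw [h]
  refine continuous_of_dominated (bound := fun _ => 1) (fun t => ?_) (fun t => ?_)
    (integrable_const _) ?_
  · exact Continuous.aestronglyMeasurable (by fun_prop)
  · exact ae_of_all _ fun x => (Complex.norm_exp_ofReal_mul_I _).le
  · exact ae_of_all _ fun x => by fun_prop

variable [FiniteDimensional ℝ E]

theorem integrable_rexp_neg_mul_sq_norm {b : ℝ} (hb : 0 < b) :
    Integrable fun v : E => Real.exp (-b * ‖v‖ ^ 2) := by
  have h := (GaussianFourier.integrable_cexp_neg_mul_sq_norm_add (b := b) (by simpa) 0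
    (0 : E)).re
  refine h.congr (ae_of_all _ fun v => ?_)
  simp only [zero_mul, add_zero]
  rw [← Complex.ofReal_neg, ← Complex.ofReal_pow, ← Complex.ofReal_mul, ← Complex.ofReal_exp]
  rfl

/-- The Gaussian energy in terms of characteristic functions: the Gaussian kernel is the Fourier
transform of a Gaussian. -/
theorem gaussEnergy_eq_integral_charFun {t : ℝ} (ht : 0 < t) (ν μ : Measure E)
    [IsProbabilityMeasure ν] [IsProbabilityMeasure μ] :
    (((Real.pi * (4 * t)) ^ (Module.finrank ℝ E / 2 : ℝ) * gaussEnergy t ν μ : ℝ) : ℂ) =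
      ∫ v : E, (Real.exp (-(4 * t)⁻¹ * ‖v‖ ^ 2) : ℂ) *
        (charFun ν v * starRingEnd ℂ (charFun μ v)) := by
  set b : ℝ := (4 * t)⁻¹ with hb
  have hb0 : 0 < b := by positivity
  have hker (w : E) : ∫ v : E, (Real.exp (-b * ‖v‖ ^ 2) : ℂ) *
      Complex.exp (inner ℝ w v * Complex.I) =
      (((Real.pi * (4 * t)) ^ (Module.finrank ℝ E / 2 : ℝ) * Real.exp (-t * ‖w‖ ^ 2) : ℝ) : ℂ) := by
    have h := GaussianFourier.integral_cexp_neg_mul_sq_norm_add (b := b) (by simpa) Complex.I w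
    convert h using 2
    · ext v
      rw [Complex.exp_add, mul_comm Complex.I]
      push_cast
      rfl
    · push_cast
      congr 1
      · rw [Complex.ofReal_cpow (by positivity), hb]
        push_cast
        rw [div_inv_eq_mul]
      · rw [Complex.I_sq, hb]
        congr 1
        push_cast
        field_simp
  have hcont : Continuous fun q : (E × E) × E =>
      Complex.exp (inner ℝ (q.1.1 - q.1.2) q.2 * Complex.I) := by fun_prop
  have hint : Integrable (Function.uncurry fun (p : E × E) (v : E) =>
      (Real.exp (-b * ‖v‖ ^ 2) : ℂ) * Complex.exp (inner ℝ (p.1 - p.2) v * Complex.I))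
      ((ν.prod μ).prod volume) := by
    have h1 : Integrable (fun q : (E × E) × E => (Real.exp (-b * ‖q.2‖ ^ 2) : ℂ))
        ((ν.prod μ).prod volume) := by
      have h0 : Integrable fun v : E => (Real.exp (-b * ‖v‖ ^ 2) : ℂ) :=
        (integrable_rexp_neg_mul_sq_norm hb0).ofReal
      exact h0.comp_snd (ν.prod μ)
    exact h1.mul_bdd (c := 1) hcont.aestronglyMeasurable
      (ae_of_all _ fun q => (Complex.norm_exp_ofReal_mul_I _).le)
  rw [gaussEnergy, ← integral_const_mul, ← integral_complex_ofReal]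
  simp_rw [← hker]
  rw [integral_integral_swap hint]
  refine integral_congr_ae (ae_of_all _ fun v => ?_)
  simp only
  rw [integral_const_mul, ← charFun_neg, charFun_apply, charFun_apply, ← integral_prod_mul]
  congr 2
  ext p
  rw [← Complex.exp_add, inner_sub_left, inner_neg_right]
  congr 1
  push_cast
  ring

theorem integrable_gauss_charFun {b : ℝ} (hb : 0 < b) (ν μ : Measure E)
    [IsProbabilityMeasure ν] [IsProbabilityMeasure μ] :
    Integrable fun v : E => (Real.exp (-b * ‖v‖ ^ 2) : ℂ) *
        (charFun ν v * starRingEnd ℂ (charFun μ v)) := by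
  have h1 : Integrable (fun v : E => (Real.exp (-b * ‖v‖ ^ 2) : ℂ)) :=
    (integrable_rexp_neg_mul_sq_norm hb).ofReal
  refine h1.mul_bdd (c := 1) (Continuous.aestronglyMeasurable ?_) (ae_of_all _ fun v => ?_)
  · exact (continuous_charFun ν).mul (Complex.continuous_conj.comp (continuous_charFun μ))
  · rw [norm_mul, RCLike.norm_conj]
    exact mul_le_one₀ (norm_charFun_le_one v) (norm_nonneg _) (norm_charFun_le_one v)

/-- The Gaussian kernel is strictly positive definite. -/
theorem two_mul_gaussEnergy_lt {t : ℝ} (ht : 0 < t) (ν μ : Measure E)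
    [IsProbabilityMeasure ν] [IsProbabilityMeasure μ] (hne : ν ≠ μ) :
    2 * gaussEnergy t ν μ < gaussEnergy t ν ν + gaussEnergy t μ μ := by
  have hb : (0 : ℝ) < (4 * t)⁻¹ := by positivity
  set c : ℝ := (Real.pi * (4 * t)) ^ (Module.finrank ℝ E / 2 : ℝ) with hc
  have hc0 : 0 < c := by positivity
  -- the defect of the inequality is `c⁻¹` times the integral of `F`
  set F : E → ℝ := fun v => Real.exp (-(4 * t)⁻¹ * ‖v‖ ^ 2) * ‖charFun ν v - charFun μ v‖ ^ 2
  have hpt (v : E) : (F v : ℂ) =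
      (Real.exp (-(4 * t)⁻¹ * ‖v‖ ^ 2) : ℂ) * (charFun ν v * starRingEnd ℂ (charFun ν v)) +
      (Real.exp (-(4 * t)⁻¹ * ‖v‖ ^ 2) : ℂ) * (charFun μ v * starRingEnd ℂ (charFun μ v)) -
      (Real.exp (-(4 * t)⁻¹ * ‖v‖ ^ 2) : ℂ) * (charFun ν v * starRingEnd ℂ (charFun μ v)) -
      (Real.exp (-(4 * t)⁻¹ * ‖v‖ ^ 2) : ℂ) * (charFun μ v * starRingEnd ℂ (charFun ν v)) := by
    simp only [F]
    push_cast
    rw [← Complex.mul_conj', map_sub]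
    ring
  have hnn := integrable_gauss_charFun hb ν ν
  have hmm := integrable_gauss_charFun hb μ μ
  have hnm := integrable_gauss_charFun hb ν μ
  have hmn := integrable_gauss_charFun hb μ ν
  have hFint : Integrable fun v => (F v : ℂ) := by
    simp only [hpt]
    exact ((hnn.add hmm).sub hnm).sub hmn
  have hFint' : Integrable F := by simpa using hFint.re
  have hsum : ((∫ v, F v : ℝ) : ℂ) = ((c * (gaussEnergy t ν ν + gaussEnergy t μ μ -
      2 * gaussEnergy t ν μ) : ℝ) : ℂ) := by
    rw [← integral_complex_ofReal]
    simp only [hpt]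
    rw [integral_sub (by exact (hnn.add hmm).sub hnm) hmn, integral_sub (hnn.fun_add hmm) hnm,
      integral_add hnn hmm, ← gaussEnergy_eq_integral_charFun ht,
      ← gaussEnergy_eq_integral_charFun ht, ← gaussEnergy_eq_integral_charFun ht,
      ← gaussEnergy_eq_integral_charFun ht,
      gaussEnergy_comm t μ ν]
    push_cast
    ring
  rw [Complex.ofReal_inj] at hsum
  have hF0 : ∀ v, 0 ≤ F v := fun v => by positivity
  have hcontF : Continuous F := by
    have h1 := continuous_charFun ν
    have h2 := continuous_charFun μ
    simp only [F]
    fun_prop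
  have hpos : 0 < ∫ v, F v := by
    refine lt_of_le_of_ne (integral_nonneg hF0) fun h0 => hne ?_
    have hae := (integral_eq_zero_iff_of_nonneg hF0 hFint').1 h0.symm
    have heq : F = 0 := (hcontF.ae_eq_iff_eq volume continuous_zero).1 hae
    refine Measure.ext_of_charFun (funext fun v => ?_)
    have hv : F v = 0 := congrFun heq v
    have := (mul_eq_zero.1 hv).resolve_left (Real.exp_pos _).ne'
    exact sub_eq_zero.1 (norm_eq_zero.1 (pow_eq_zero_iff two_ne_zero |>.1 this))
  rw [hsum] at hpos
  have := pos_of_mul_pos_right hpos hc0.le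
  linarith

end Gaussian

/-! ### Logarithmic energy -/

/-- The nonnegative logarithmic kernel `log (R / |z - w|)` of the sets of diameter at most `R`. -/
def posLogKernel (R : ℝ) (z w : ℂ) : ℝ≥0∞ :=
  if z = w then ⊤ else ENNReal.ofReal (Real.log (R / ‖z - w‖))

/-- The mutual energy of two measures for the kernel `log (R / |z - w|)`. -/
def mutualEnergy (R : ℝ) (ν μ : Measure ℂ) : ℝ≥0∞ :=
  ∫⁻ z, ∫⁻ w, posLogKernel R z w ∂μ ∂ν

/-- The slices of the decomposition of the logarithmic kernel into Gaussian kernels. -/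
def gaussSlice (R t : ℝ) (p : ℂ × ℂ) : ℝ≥0∞ :=
  ENNReal.ofReal ((2 * t)⁻¹ * (Real.exp (-t * ‖p.1 - p.2‖ ^ 2) - Real.exp (-t * R ^ 2)))

theorem measurable_posLogKernel (R : ℝ) :
    Measurable fun p : ℂ × ℂ => posLogKernel R p.1 p.2 := by
  unfold posLogKernel
  refine Measurable.ite (measurableSet_eq_fun measurable_fst measurable_snd) measurable_const ?_
  fun_prop

theorem measurable_gaussSlice (R : ℝ) :
    Measurable fun q : (ℂ × ℂ) × ℝ => gaussSlice R q.2 q.1 := by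
  unfold gaussSlice
  fun_prop

theorem integrableOn_frullani_exp {a b : ℝ} (ha : 0 < a) (hab : a ≤ b) :
    IntegrableOn (fun t : ℝ => t⁻¹ • (Real.exp (-(a * t)) - Real.exp (-(b * t)))) (Set.Ioi 0) := by
  have hdom : IntegrableOn (fun t : ℝ => (b - a) * Real.exp (-a * t)) (Set.Ioi 0) :=
    (exp_neg_integrableOn_Ioi 0 ha).const_mul _
  refine hdom.mono' (Measurable.aestronglyMeasurable (by fun_prop)) ?_
  filter_upwards [ae_restrict_mem measurableSet_Ioi] with t ht
  have ht0 : 0 < t := ht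
  have h1 : Real.exp (-(b * t)) ≤ Real.exp (-(a * t)) :=
    Real.exp_le_exp.2 (by nlinarith)
  have h2 : Real.exp (-(b * t)) = Real.exp (-(a * t)) * Real.exp (-((b - a) * t)) := by
    rw [← Real.exp_add]; congr 1; ring
  have h3 := Real.add_one_le_exp (-((b - a) * t))
  have h4 := Real.exp_pos (-(a * t))
  rw [smul_eq_mul, Real.norm_eq_abs, abs_of_nonneg (mul_nonneg (inv_nonneg.2 ht0.le)
    (sub_nonneg.2 h1)), inv_mul_le_iff₀ ht0, h2, neg_mul]
  nlinarith

/-- Frullani's integral for the exponential. -/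
theorem lintegral_frullani_exp {a b : ℝ} (ha : 0 < a) (hab : a ≤ b) :
    ∫⁻ t in Set.Ioi 0, ENNReal.ofReal ((2 * t)⁻¹ * (Real.exp (-t * a) - Real.exp (-t * b))) =
      ENNReal.ofReal (Real.log (b / a) / 2) := by
  have hb := ha.trans_le hab
  have hF := Frullani.integral_Ioi_eq (f := fun x : ℝ => Real.exp (-x)) (L := 1) (R := 0)
    ((Continuous.locallyIntegrable (by fun_prop)).locallyIntegrableOn _) ha hb ?_ ?_
    (integrableOn_frullani_exp ha hab)
  · have hform (t : ℝ) : (2 * t)⁻¹ * (Real.exp (-t * a) - Real.exp (-t * b)) =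
        (t⁻¹ • (Real.exp (-(a * t)) - Real.exp (-(b * t)))) / 2 := by
      rw [smul_eq_mul, mul_inv, neg_mul, neg_mul, mul_comm t a, mul_comm t b]; ring
    simp only [hform]
    rw [← ofReal_integral_eq_lintegral_ofReal, integral_div, hF]
    · simp
    · exact (integrableOn_frullani_exp ha hab).div_const 2
    · filter_upwards [ae_restrict_mem measurableSet_Ioi] with t ht
      have ht0 : 0 < t := ht
      have h1 : Real.exp (-(b * t)) ≤ Real.exp (-(a * t)) :=
        Real.exp_le_exp.2 (by nlinarith)
      exact div_nonneg (mul_nonneg (inv_nonneg.2 ht0.le) (sub_nonneg.2 h1)) two_pos.le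
  · have : Continuous fun x : ℝ => Real.exp (-x) := by fun_prop
    simpa using (this.tendsto 0).mono_left nhdsWithin_le_nhds
  · exact Real.tendsto_exp_neg_atTop_nhds_zero

/-- The logarithmic kernel is a superposition of Gaussian kernels up to constants, by Frullani's
integral. On the diagonal both sides are infinite. -/
theorem posLogKernel_eq_lintegral {R : ℝ} (hR : 0 < R) {z w : ℂ} (hzw : ‖z - w‖ ≤ R) :
    posLogKernel R z w = ∫⁻ t in Set.Ioi 0, gaussSlice R t (z, w) := by
  by_cases h : z = w
  · subst h
    rw [posLogKernel, if_pos rfl, eq_comm]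
    refine ENNReal.eq_top_of_forall_nnreal_le fun M => ?_
    -- compare with the kernel at a small positive distance
    set a : ℝ := R ^ 2 * Real.exp (-(2 * M)) with ha
    have ha0 : 0 < a := by positivity
    have hab : a ≤ R ^ 2 := by
      refine mul_le_of_le_one_right (by positivity) (Real.exp_le_one_iff.2 ?_)
      have := M.coe_nonneg
      linarith
    have hlog : Real.log (R ^ 2 / a) / 2 = M := by
      rw [ha, ← div_div, div_self (by positivity), one_div, ← Real.exp_neg, neg_neg, Real.log_exp]
      ring
    rw [← ENNReal.ofReal_coe_nnreal, ← hlog, ← lintegral_frullani_exp ha0 hab]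
    refine setLIntegral_mono' measurableSet_Ioi fun t ht => ?_
    have ht0 : 0 < t := ht
    refine ENNReal.ofReal_le_ofReal (mul_le_mul_of_nonneg_left ?_ (by positivity))
    refine sub_le_sub_right (Real.exp_le_exp.2 ?_) _
    simp only [sub_self, norm_zero]
    nlinarith
  · have hd : 0 < ‖z - w‖ := norm_pos_iff.2 (sub_ne_zero.2 h)
    rw [posLogKernel, if_neg h]
    unfold gaussSlice
    simp only
    rw [lintegral_frullani_exp (by positivity) (pow_le_pow_left₀ hd.le hzw 2), ← div_pow,
      Real.log_pow]
    congr 1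
    push_cast
    ring

section Energy

variable {S : Set ℂ} {R : ℝ}

theorem ae_mem_of_compl_null {ν : Measure ℂ} (hν : ν Sᶜ = 0) : ∀ᵐ z ∂ν, z ∈ S :=
  mem_ae_iff.2 hν

theorem ae_prod_norm_sub_le (hS : ∀ z ∈ S, ∀ w ∈ S, ‖z - w‖ ≤ R) {ν μ : Measure ℂ}
    [SFinite ν] [SFinite μ] (hν : ν Sᶜ = 0) (hμ : μ Sᶜ = 0) :
    ∀ᵐ p ∂(ν.prod μ), ‖p.1 - p.2‖ ≤ R := by
  have h1 := Measure.quasiMeasurePreserving_fst (μ := ν) (ν := μ) |>.ae (ae_mem_of_compl_null hν)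
  have h2 := Measure.quasiMeasurePreserving_snd (μ := ν) (ν := μ) |>.ae (ae_mem_of_compl_null hμ)
  filter_upwards [h1, h2] with p hp1 hp2 using hS _ hp1 _ hp2

/-- Tonelli's theorem applied to the decomposition of the logarithmic kernel into its slices. -/
theorem mutualEnergy_eq_lintegral_slices (hR : 0 < R) (hS : ∀ z ∈ S, ∀ w ∈ S, ‖z - w‖ ≤ R)
    {ν μ : Measure ℂ} [SFinite ν] [SFinite μ] (hν : ν Sᶜ = 0) (hμ : μ Sᶜ = 0) :
    mutualEnergy R ν μ = ∫⁻ t in Set.Ioi 0, ∫⁻ p, gaussSlice R t p ∂(ν.prod μ) := by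
  rw [mutualEnergy, lintegral_lintegral (measurable_posLogKernel R).aemeasurable,
    ← lintegral_lintegral_swap (measurable_gaussSlice R).aemeasurable]
  refine lintegral_congr_ae ?_
  filter_upwards [ae_prod_norm_sub_le hS hν hμ] with p hp
  exact posLogKernel_eq_lintegral hR hp

/-- The energy of a slice is a Gaussian energy up to constants that depend only on the total masses,
which is why these constants cancel between probability measures. -/
theorem lintegral_gaussSlice (hS : ∀ z ∈ S, ∀ w ∈ S, ‖z - w‖ ≤ R)
    {ν μ : Measure ℂ} [IsProbabilityMeasure ν] [IsProbabilityMeasure μ] (hν : ν Sᶜ = 0)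
    (hμ : μ Sᶜ = 0) {t : ℝ} (ht : 0 < t) :
    0 ≤ gaussEnergy t ν μ - Real.exp (-t * R ^ 2) ∧
    ∫⁻ p, gaussSlice R t p ∂(ν.prod μ) =
      ENNReal.ofReal ((2 * t)⁻¹ * (gaussEnergy t ν μ - Real.exp (-t * R ^ 2))) := by
  have hint : Integrable (fun p : ℂ × ℂ => Real.exp (-t * ‖p.1 - p.2‖ ^ 2)) (ν.prod μ) := by
    refine Integrable.of_bound (Continuous.aestronglyMeasurable (by fun_prop)) 1
      (ae_of_all _ fun p => ?_)
    rw [Real.norm_eq_abs, Real.abs_exp]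
    exact Real.exp_le_one_iff.2 (by nlinarith [sq_nonneg ‖p.1 - p.2‖])
  have heq : gaussEnergy t ν μ - Real.exp (-t * R ^ 2) =
      ∫ p : ℂ × ℂ, (Real.exp (-t * ‖p.1 - p.2‖ ^ 2) - Real.exp (-t * R ^ 2)) ∂(ν.prod μ) := by
    rw [integral_sub hint (integrable_const _), gaussEnergy]
    simp
  have hnn : 0 ≤ᵐ[ν.prod μ] fun p : ℂ × ℂ =>
      Real.exp (-t * ‖p.1 - p.2‖ ^ 2) - Real.exp (-t * R ^ 2) := by
    filter_upwards [ae_prod_norm_sub_le hS hν hμ] with p hp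
    refine sub_nonneg.2 (Real.exp_le_exp.2 ?_)
    have := pow_le_pow_left₀ (norm_nonneg _) hp 2
    nlinarith
  rw [heq]
  refine ⟨integral_nonneg_of_ae hnn, ?_⟩
  rw [← integral_const_mul, ofReal_integral_eq_lintegral_ofReal]
  · rfl
  · exact (hint.sub (integrable_const _)).const_mul _
  · filter_upwards [hnn] with p hp
    exact mul_nonneg (by positivity) hp

/-- Strict positive definiteness of the logarithmic kernel on probability measures. The inequality
holds slice by slice; finiteness of the left-hand side keeps it strict after integration. -/
theorem two_mul_mutualEnergy_lt (hR : 0 < R) (hS : ∀ z ∈ S, ∀ w ∈ S, ‖z - w‖ ≤ R)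
    {ν μ : Measure ℂ} [IsProbabilityMeasure ν] [IsProbabilityMeasure μ] (hν : ν Sᶜ = 0)
    (hμ : μ Sᶜ = 0) (hne : ν ≠ μ) (hfin : mutualEnergy R ν μ ≠ ⊤) :
    2 * mutualEnergy R ν μ < mutualEnergy R ν ν + mutualEnergy R μ μ := by
  have hmeas (ν μ : Measure ℂ) [SFinite ν] [SFinite μ] :
      Measurable fun t : ℝ => ∫⁻ p, gaussSlice R t p ∂(ν.prod μ) :=
    (measurable_gaussSlice R).lintegral_prod_left'
  have hfin2 := ENNReal.mul_ne_top ENNReal.ofNat_ne_top hfin (a := 2)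
  rw [mutualEnergy_eq_lintegral_slices hR hS hν hμ] at hfin2 ⊢
  rw [mutualEnergy_eq_lintegral_slices hR hS hν hν, mutualEnergy_eq_lintegral_slices hR hS hμ hμ,
    ← lintegral_add_left (hmeas ν ν)]
  rw [← lintegral_const_mul _ (hmeas ν μ)] at hfin2 ⊢
  refine lintegral_strict_mono (by simp) ((hmeas ν ν).add (hmeas μ μ)).aemeasurable hfin2 ?_
  filter_upwards [ae_restrict_mem measurableSet_Ioi] with t ht
  have ht0 : 0 < t := ht
  obtain ⟨h1, e1⟩ := lintegral_gaussSlice hS hν hν ht0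
  obtain ⟨h2, e2⟩ := lintegral_gaussSlice hS hμ hμ ht0
  obtain ⟨h3, e3⟩ := lintegral_gaussSlice hS hν hμ ht0
  have hlt := two_mul_gaussEnergy_lt ht0 ν μ hne
  have hi : 0 < (2 * t)⁻¹ := by positivity
  rw [e1, e2, e3, ← ENNReal.ofReal_add (mul_nonneg hi.le h1) (mul_nonneg hi.le h2),
    ← ENNReal.ofReal_ofNat, ← ENNReal.ofReal_mul zero_le_two, ENNReal.ofReal_lt_ofReal_iff_of_nonneg
      (mul_nonneg zero_le_two (mul_nonneg hi.le h3))]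
  nlinarith

theorem logKernel_toENNReal_add (hR : 1 ≤ R) {z w : ℂ} (hzw : ‖z - w‖ ≤ R) :
    (logKernel z w).toENNReal + ENNReal.ofReal (Real.log R) =
      posLogKernel R z w + (-logKernel z w).toENNReal := by
  by_cases h : z = w
  · simp [logKernel, posLogKernel, h]
  · have hd : 0 < ‖z - w‖ := norm_pos_iff.2 (sub_ne_zero.2 h)
    have hlR := Real.log_nonneg hR
    have hle : Real.log ‖z - w‖ ≤ Real.log R := Real.log_le_log hd hzw
    rw [logKernel, posLogKernel, if_neg h, if_neg h, ← EReal.coe_neg, neg_neg,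
      EReal.toENNReal_of_ne_top (EReal.coe_ne_top _),
      EReal.toENNReal_of_ne_top (EReal.coe_ne_top _),
      EReal.toReal_coe, EReal.toReal_coe, Real.log_div (by positivity) hd.ne']
    rcases le_total (Real.log ‖z - w‖) 0 with h0 | h0
    · rw [ENNReal.ofReal_of_nonpos h0, add_zero, ← ENNReal.ofReal_add (by linarith) hlR]
      congr 1; ring
    · rw [ENNReal.ofReal_of_nonpos (by linarith : -Real.log ‖z - w‖ ≤ 0), zero_add,
        ← ENNReal.ofReal_add (by linarith) h0]
      congr 1; ring

/-- On a set of diameter at most `R` the logarithmic energy is the energy for the kernel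
`log (R / |z - w|)`, up to the constant `log R`. -/
theorem logEnergy_eq (hR : 1 ≤ R) (hS : ∀ z ∈ S, ∀ w ∈ S, ‖z - w‖ ≤ R)
    (ν : ProbabilityMeasure ℂ) (hν : (ν : Measure ℂ) Sᶜ = 0) :
    logEnergy ν = (mutualEnergy R ν ν : EReal) - (Real.log R : ℝ) := by
  have hlR := Real.log_nonneg hR
  set P := ∫⁻ z, ∫⁻ w, (logKernel z w).toENNReal ∂(ν : Measure ℂ) ∂(ν : Measure ℂ) with hP
  set N := ∫⁻ z, ∫⁻ w, (-logKernel z w).toENNReal ∂(ν : Measure ℂ) ∂(ν : Measure ℂ) with hN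
  have hmem := ae_mem_of_compl_null hν
  have hadd : P + ENNReal.ofReal (Real.log R) = mutualEnergy R ν ν + N := by
    have hmeas : Measurable fun p : ℂ × ℂ => posLogKernel R p.1 p.2 := measurable_posLogKernel R
    have h1 : P + ENNReal.ofReal (Real.log R) = ∫⁻ z, ∫⁻ w, ((logKernel z w).toENNReal +
        ENNReal.ofReal (Real.log R)) ∂(ν : Measure ℂ) ∂(ν : Measure ℂ) := by
      simp [lintegral_add_right _ measurable_const, hP]
    rw [h1, mutualEnergy, hN, ← lintegral_add_left hmeas.lintegral_prod_right']
    refine lintegral_congr_ae ?_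
    filter_upwards [hmem] with z hz
    have hz' : Measurable fun w => posLogKernel R z w := hmeas.comp measurable_prodMk_left
    rw [← lintegral_add_left hz']
    refine lintegral_congr_ae ?_
    filter_upwards [hmem] with w hw
    exact logKernel_toENNReal_add hR (hS z hz w hw)
  have hNfin : N ≠ ⊤ := by
    have : N ≤ ∫⁻ _, ∫⁻ _, ENNReal.ofReal (Real.log R) ∂(ν : Measure ℂ) ∂(ν : Measure ℂ) := by
      refine lintegral_mono_ae ?_
      filter_upwards [hmem] with z hz
      refine lintegral_mono_ae ?_
      filter_upwards [hmem] with w hw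
      by_cases h : z = w
      · simp [logKernel, h]
      · rw [logKernel, if_neg h, ← EReal.coe_neg, neg_neg,
          EReal.toENNReal_of_ne_top (EReal.coe_ne_top _), EReal.toReal_coe]
        exact ENNReal.ofReal_le_ofReal (Real.log_le_log (norm_pos_iff.2 (sub_ne_zero.2 h))
          (hS z hz w hw))
    refine ne_top_of_le_ne_top ?_ this
    simp
  change (P : EReal) - (N : EReal) = _
  lift N to ℝ≥0 using hNfin with n
  by_cases hPtop : P = ⊤
  · have : mutualEnergy R ν ν = ⊤ := by
      by_contra h
      rw [hPtop, top_add] at hadd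
      exact (ENNReal.add_ne_top.2 ⟨h, ENNReal.coe_ne_top⟩) hadd.symm
    rw [hPtop, this]
    rfl
  · have hL : mutualEnergy R ν ν ≠ ⊤ := by
      intro h
      rw [h, top_add] at hadd
      exact (ENNReal.add_ne_top.2 ⟨hPtop, ENNReal.ofReal_ne_top⟩) hadd
    lift P to ℝ≥0 using hPtop with p
    lift mutualEnergy R ν ν to ℝ≥0 using hL with m
    rw [ENNReal.ofReal, ← ENNReal.coe_add, ← ENNReal.coe_add, ENNReal.coe_inj] at hadd
    have hreal := congrArg NNReal.toReal hadd
    rw [NNReal.coe_add, NNReal.coe_add, Real.coe_toNNReal _ hlR] at hreal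
    have e1 (x : ℝ≥0) : (((x : ℝ≥0∞)) : EReal) = ((x : ℝ) : EReal) := rfl
    rw [e1, e1, e1, ← EReal.coe_sub, ← EReal.coe_sub]
    congr 1
    linarith

theorem log_inv_logCapacity (K : Set ℂ) : ENNReal.log (logCapacity K)⁻¹ = minEnergy K := by
  rw [logCapacity, ENNReal.log_inv, EReal.log_exp, neg_neg]

/-- A probability measure `μ` whose logarithmic potential is constant on `K` is the unique
equilibrium measure of `K`: the mutual energy of `μ` with each probability measure on `K` is the
same constant, and strict positive definiteness makes every other energy larger. -/
theorem isEquilibriumMeasure_of_potential_const {K : Set ℂ} (hR : 1 ≤ R)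
    (hK : ∀ z ∈ K, ∀ w ∈ K, ‖z - w‖ ≤ R) (μ : ProbabilityMeasure ℂ)
    (hμ : (μ : Measure ℂ) Kᶜ = 0) {c : ℝ≥0∞} (hc : c ≠ ⊤)
    (hpot : ∀ z ∈ K, ∫⁻ w, posLogKernel R z w ∂(μ : Measure ℂ) = c) :
    IsEquilibriumMeasure K μ ∧ ∀ ν : ProbabilityMeasure ℂ, IsEquilibriumMeasure K ν → ν = μ := by
  have hmut (ν : ProbabilityMeasure ℂ) (hν : (ν : Measure ℂ) Kᶜ = 0) :
      mutualEnergy R ν μ = c := by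
    rw [mutualEnergy, lintegral_congr_ae (g := fun _ => c)]
    · simp
    · filter_upwards [ae_mem_of_compl_null hν] with z hz using hpot z hz
  have hlt (ν : ProbabilityMeasure ℂ) (hν : (ν : Measure ℂ) Kᶜ = 0) (hne : ν ≠ μ) :
      c < mutualEnergy R ν ν := by
    have h := two_mul_mutualEnergy_lt (zero_lt_one.trans_le hR) hK hν hμ
      (fun h => hne (Subtype.ext h)) (by rw [hmut ν hν]; exact hc)
    rw [hmut ν hν, hmut μ hμ, two_mul] at h
    exact lt_of_add_lt_add_right h
  have hE (ν : ProbabilityMeasure ℂ) (hν : (ν : Measure ℂ) Kᶜ = 0) := logEnergy_eq hR hK ν hν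
  have hEμ : logEnergy μ = ((c.toReal - Real.log R : ℝ) : EReal) := by
    rw [hE μ hμ, hmut μ hμ, EReal.coe_sub, EReal.coe_ennreal_toReal hc]
  have hmin : minEnergy K = logEnergy μ := by
    refine le_antisymm (iInf₂_le μ hμ) (le_iInf₂ fun ν hν => ?_)
    by_cases hne : ν = μ
    · rw [hne]
    · rw [hE μ hμ, hE ν hν, hmut μ hμ]
      exact EReal.sub_le_sub (EReal.coe_ennreal_le_coe_ennreal_iff.2 (hlt ν hν hne).le) le_rfl
  refine ⟨⟨?_, hμ, ?_⟩, fun ν ⟨_, hν, hνE⟩ => ?_⟩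
  · rw [logCapacity, Ne, EReal.exp_eq_zero_iff, hmin, hEμ, ← EReal.coe_neg]
    exact EReal.coe_ne_bot _
  · rw [log_inv_logCapacity, hmin]
  · by_contra hne
    rw [log_inv_logCapacity, hmin, hEμ, hE ν hν] at hνE
    have h1 := hlt ν hν hne
    have hfin : mutualEnergy R ν ν ≠ ⊤ := by
      intro htop
      rw [htop] at hνE
      exact absurd hνE (EReal.top_sub_coe _ ▸ (EReal.coe_ne_top _).symm)
    rw [← EReal.coe_ennreal_toReal hfin, ← EReal.coe_sub, EReal.coe_eq_coe_iff] at hνE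
    have h2 := (ENNReal.toReal_lt_toReal hc hfin).2 h1
    linarith

end Energy

/-! ### Fibre measures and the pullback of the arcsine distribution -/

section Fibre

variable {Q : ℂ[X]}

theorem isCompact_preimage_eval (hQ : 0 < Q.natDegree) {s : Set ℂ} (hs : IsCompact s) :
    IsCompact {z | Q.eval z ∈ s} :=
  (Q.isProperMap_eval (natDegree_pos_iff_degree_pos.1 hQ)).isCompact_preimage hs

/-- Continuity of the roots, in the form needed for weak convergence. The vectors of roots over a
compact set of base points stay in a compact set, and a limit of such vectors is a vector of roots
of the limit polynomial. -/
theorem continuous_fibreSum (hQ : 0 < Q.natDegree) {M : Type*} [AddCommMonoid M]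
    [TopologicalSpace M] [ContinuousAdd M] {f : ℂ → M} (hf : Continuous f) :
    Continuous (fibreSum Q f) := by
  rw [continuous_iff_seqContinuous]
  intro w w₀ hw
  refine tendsto_of_subseq_tendsto fun ns hns => ?_
  have hroots (v : ℂ) := (Q - C v).roots.exists_eq_map_univ_fin (card_roots_sub_C v)
  choose x hx using hroots
  have hev (v z : ℂ) : Q.eval z - v = Q.leadingCoeff * ∏ i, (z - x v i) := by
    have h := (IsAlgClosed.splits (Q - C v)).eval_eq_prod_roots z
    rw [leadingCoeff_sub_C hQ, eval_sub, eval_C, hx v, Multiset.map_map] at h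
    exact h
  have hK : IsCompact {z | Q.eval z ∈ insert w₀ (Set.range w)} :=
    isCompact_preimage_eval hQ hw.isCompact_insert_range
  have hxK (m : ℕ) : x (w (ns m)) ∈ Set.univ.pi fun _ : Fin Q.natDegree =>
      {z | Q.eval z ∈ insert w₀ (Set.range w)} := by
    intro i _
    have hmem : x (w (ns m)) i ∈ (Q - C (w (ns m))).roots := by
      rw [hx]
      exact Multiset.mem_map_of_mem _ (Finset.mem_univ i)
    have := (mem_roots_sub_C hQ).1 hmem
    exact Set.mem_insert_of_mem _ ⟨ns m, this.symm⟩
  obtain ⟨y, -, φ, hφ, hlim⟩ := (isCompact_univ_pi fun _ => hK).tendsto_subseq hxK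
  refine ⟨φ, ?_⟩
  have hlimi (i) : Tendsto (fun m => x (w (ns (φ m))) i) atTop (𝓝 (y i)) :=
    (tendsto_pi_nhds.1 hlim) i
  have hwlim : Tendsto (fun m => w (ns (φ m))) atTop (𝓝 w₀) :=
    hw.comp (hns.comp hφ.tendsto_atTop)
  have hy : Q - C w₀ = C Q.leadingCoeff * ∏ i, (X - C (y i)) := by
    refine Polynomial.funext fun z => ?_
    have h1 : Tendsto (fun m => Q.leadingCoeff * ∏ i, (z - x (w (ns (φ m))) i)) atTop
        (𝓝 (Q.leadingCoeff * ∏ i, (z - y i))) :=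
      (tendsto_finsetProd _ fun i _ => (hlimi i).const_sub z).const_mul _
    have h2 : Tendsto (fun m => Q.eval z - w (ns (φ m))) atTop (𝓝 (Q.eval z - w₀)) :=
      hwlim.const_sub _
    simp only [hev] at h2
    have := tendsto_nhds_unique h2 (by simpa only [← hev] using h1)
    rw [eval_sub, eval_C, hev, this, eval_mul, eval_C, eval_prod]
    simp
  have hyroots : (Q - C w₀).roots = Finset.univ.val.map y := by
    rw [hy, roots_C_mul _ (leadingCoeff_ne_zero.2 (ne_zero_of_natDegree_gt hQ)),
      roots_prod _ _ (Finset.prod_ne_zero_iff.2 fun i _ => X_sub_C_ne_zero _)]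
    simp [Multiset.bind_singleton]
  have h1 (v : ℂ) : fibreSum Q f v = ∑ i, f (x v i) := by
    rw [fibreSum, hx v, Multiset.map_map]
    rfl
  have h2 : fibreSum Q f w₀ = ∑ i, f (y i) := by
    rw [fibreSum, hyroots, Multiset.map_map]
    rfl
  rw [h2]
  refine Tendsto.congr (fun m => (h1 _).symm) ?_
  exact tendsto_finsetSum _ fun i _ => (hf.tendsto _).comp (hlimi i)

theorem lintegral_sum_map_dirac (s : Multiset ℂ) {f : ℂ → ℝ≥0∞} (hf : Measurable f) :
    ∫⁻ z, f z ∂(s.map Measure.dirac).sum = (s.map f).sum := by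
  induction s using Multiset.induction_on with
  | empty => simp
  | cons a s ih => simp [lintegral_add_measure, ih, lintegral_dirac' a hf]

/-- The uniform probability measure on the fibre of `Q` above `w`, with multiplicity. -/
def fibreMeasure (Q : ℂ[X]) (w : ℂ) : Measure ℂ :=
  (Q.natDegree : ℝ≥0∞)⁻¹ • ((Q - C w).roots.map Measure.dirac).sum

theorem lintegral_fibreMeasure (w : ℂ) {f : ℂ → ℝ≥0∞} (hf : Measurable f) :
    ∫⁻ z, f z ∂(fibreMeasure Q w) = (Q.natDegree : ℝ≥0∞)⁻¹ * fibreSum Q f w := by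
  rw [fibreMeasure, lintegral_smul_measure, lintegral_sum_map_dirac _ hf, smul_eq_mul, fibreSum]

theorem isProbabilityMeasure_fibreMeasure (hQ : 0 < Q.natDegree) (w : ℂ) :
    IsProbabilityMeasure (fibreMeasure Q w) := by
  constructor
  rw [← lintegral_one, lintegral_fibreMeasure w measurable_const, fibreSum]
  simp only [Multiset.map_const', Multiset.sum_replicate, card_roots_sub_C, nsmul_one]
  exact ENNReal.inv_mul_cancel (by exact_mod_cast hQ.ne') (ENNReal.natCast_ne_top _)

theorem measurable_fibreMeasure (hQ : 0 < Q.natDegree) : Measurable (fibreMeasure Q) := by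
  have := isProbabilityMeasure_fibreMeasure hQ
  refine Measurable.measure_of_isPiSystem_of_isProbabilityMeasure (S := {F | IsClosed F})
    (by rw [BorelSpace.measurable_eq (α := ℂ), borel_eq_generateFrom_isClosed])
    isPiSystem_isClosed fun F hF => ?_
  -- the measure of a closed set is a limit of integrals of continuous functions
  have hδ (n : ℕ) : (0 : ℝ) < 1 / ((n : ℝ) + 1) := by positivity
  refine measurable_of_tendsto_metrizable (f := fun (n : ℕ) w =>
    ∫⁻ z, (thickenedIndicator (hδ n) F z : ℝ≥0∞) ∂(fibreMeasure Q w)) (fun n => ?_)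
    (tendsto_pi_nhds.2 fun w => tendsto_lintegral_thickenedIndicator_of_isClosed _ hF hδ
      tendsto_one_div_add_atTop_nhds_zero_nat)
  have hc : Continuous fun z => (thickenedIndicator (hδ n) F z : ℝ≥0∞) :=
    ENNReal.continuous_coe.comp (thickenedIndicator (hδ n) F).continuous
  simp only [lintegral_fibreMeasure _ hc.measurable]
  exact (continuous_fibreSum hQ hc).measurable.const_mul _

/-- The pullback to the preimage of `[-2, 2]` under `Q` of the arcsine distribution: the mean of the
fibre measures above the points `2 cos (π s)`, where `s` is uniform in `[0, 1]`. -/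
def arcsinePullback (Q : ℂ[X]) : Measure ℂ :=
  (volume.restrict (Set.Ioc (0 : ℝ) 1)).bind fun s =>
    fibreMeasure Q ((2 * Real.cos (Real.pi * s) : ℝ) : ℂ)

theorem measurable_fibreMeasure_cos (hQ : 0 < Q.natDegree) :
    Measurable fun s : ℝ => fibreMeasure Q ((2 * Real.cos (Real.pi * s) : ℝ) : ℂ) :=
  (measurable_fibreMeasure hQ).comp (Continuous.measurable (by fun_prop))

theorem lintegral_arcsinePullback (hQ : 0 < Q.natDegree) {f : ℂ → ℝ≥0∞} (hf : Measurable f) :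
    ∫⁻ z, f z ∂(arcsinePullback Q) = ∫⁻ s in Set.Ioc (0 : ℝ) 1,
      (Q.natDegree : ℝ≥0∞)⁻¹ * fibreSum Q f ((2 * Real.cos (Real.pi * s) : ℝ) : ℂ) := by
  rw [arcsinePullback, Measure.lintegral_bind (measurable_fibreMeasure_cos hQ).aemeasurable
    hf.aemeasurable]
  simp only [lintegral_fibreMeasure _ hf]

theorem isProbabilityMeasure_arcsinePullback (hQ : 0 < Q.natDegree) :
    IsProbabilityMeasure (arcsinePullback Q) := by
  have := isProbabilityMeasure_fibreMeasure hQ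
  constructor
  rw [arcsinePullback, Measure.bind_apply MeasurableSet.univ
    (measurable_fibreMeasure_cos hQ).aemeasurable]
  simp

theorem isCompact_segmentPreimage (hQ : 0 < Q.natDegree) : IsCompact (segmentPreimage Q) := by
  have h := isCompact_preimage_eval hQ ((isCompact_Icc (a := (-2 : ℝ)) (b := 2)).image
    Complex.continuous_ofReal)
  convert h using 1
  ext z
  simp [segmentPreimage, eq_comm]

theorem two_mul_cos_mem (x : ℝ) : 2 * Real.cos x ∈ Set.Icc (-2 : ℝ) 2 :=
  ⟨by linarith [Real.neg_one_le_cos x], by linarith [Real.cos_le_one x]⟩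

/-- The pullback of the arcsine distribution is supported in the preimage of `[-2, 2]`. -/
theorem arcsinePullback_compl (hQ : 0 < Q.natDegree) :
    arcsinePullback Q (segmentPreimage Q)ᶜ = 0 := by
  have hm : MeasurableSet (segmentPreimage Q)ᶜ :=
    (isCompact_segmentPreimage hQ).isClosed.measurableSet.compl
  rw [← lintegral_indicator_one hm, lintegral_arcsinePullback hQ (measurable_one.indicator hm)]
  have h0 (x : ℝ) : fibreSum Q ((segmentPreimage Q)ᶜ.indicator (1 : ℂ → ℝ≥0∞))
      ((2 * Real.cos x : ℝ) : ℂ) = 0 := by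
    refine Multiset.sum_eq_zero fun y hy => ?_
    obtain ⟨z, hz, rfl⟩ := Multiset.mem_map.1 hy
    exact Set.indicator_of_notMem (by
      rw [Set.notMem_compl_iff]
      exact ⟨_, two_mul_cos_mem x, (mem_roots_sub_C hQ).1 hz⟩) _
  simp only [h0, mul_zero, lintegral_zero]

end Fibre

/-! ### Riemann sums -/

/-- Midpoint Riemann sums of a continuous function on `[0, 1]`. -/
theorem tendsto_midpoint_sum {h : ℝ → ℝ} (hc : Continuous h) :
    Tendsto (fun n : ℕ => (n : ℝ)⁻¹ * ∑ k ∈ Finset.range n, h ((2 * k + 1) / (2 * n))) atTop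
      (𝓝 (∫ s in (0 : ℝ)..1, h s)) := by
  rw [Metric.tendsto_atTop]
  intro ε hε
  have huc := isCompact_Icc (a := (0 : ℝ)) (b := 1) |>.uniformContinuousOn_of_continuous
    hc.continuousOn
  obtain ⟨δ, hδ, hδh⟩ := Metric.uniformContinuousOn_iff.1 huc (ε / 2) (half_pos hε)
  obtain ⟨N, hN⟩ := exists_nat_one_div_lt hδ
  refine ⟨N + 1, fun n hn => ?_⟩
  have hn0 : (0 : ℝ) < n := by exact_mod_cast (by omega : 0 < n)
  have hnδ : 1 / (n : ℝ) < δ := by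
    refine lt_of_le_of_lt (one_div_le_one_div_of_le (by positivity) ?_) hN
    exact_mod_cast hn
  have hsplit : ∫ s in (0 : ℝ)..1, h s =
      ∑ k ∈ Finset.range n, ∫ s in (k / n : ℝ)..((k + 1 : ℕ) / n : ℝ), h s := by
    rw [intervalIntegral.sum_integral_adjacent_intervals (a := fun k : ℕ => (k / n : ℝ))
      fun k _ => hc.intervalIntegrable _ _]
    simp [div_self hn0.ne']
  rw [hsplit, Finset.mul_sum, dist_eq_norm, ← Finset.sum_sub_distrib]
  refine lt_of_le_of_lt (norm_sum_le_of_le _ (f := fun k => _) (n := fun _ => ε / 2 / n) ?_) ?_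
  · intro k hk
    have hk' : ((k : ℝ) + 1) ≤ n := by exact_mod_cast Finset.mem_range.1 hk
    have hconst : (n : ℝ)⁻¹ * h ((2 * k + 1) / (2 * n)) =
        ∫ _ in (k / n : ℝ)..((k + 1 : ℕ) / n : ℝ), h ((2 * k + 1) / (2 * n)) := by
      rw [intervalIntegral.integral_const, smul_eq_mul]
      congr 1
      push_cast
      field_simp
      ring
    rw [hconst, ← intervalIntegral.integral_sub (by simp) (hc.intervalIntegrable _ _)]
    have hkn : (k / n : ℝ) ≤ ((k + 1 : ℕ) / n : ℝ) := by
      gcongr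
      simp
    refine (intervalIntegral.norm_integral_le_of_norm_le_const (C := ε / 2) fun s hs => ?_).trans
      (le_of_eq ?_)
    · rw [Set.uIoc_of_le hkn] at hs
      push_cast at hs
      have h1 := hs.1
      have h2 := hs.2
      rw [div_lt_iff₀ hn0] at h1
      rw [le_div_iff₀ hn0] at h2
      have hk0 : (0 : ℝ) ≤ k := k.cast_nonneg
      rw [← dist_eq_norm]
      refine (hδh _ ⟨by positivity, ?_⟩ _ ⟨?_, ?_⟩ ?_).le
      · rw [div_le_one (by positivity)]; linarith
      · by_contra! h; nlinarith
      · by_contra! h; nlinarith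
      · refine lt_of_le_of_lt ?_ hnδ
        rw [Real.dist_eq, abs_le]
        constructor
        · rw [← sub_nonneg]
          have : (2 * k + 1) / (2 * (n : ℝ)) - s - -(1 / n) =
            ((2 * k + 1) / 2 + 1 - s * n) / n := by field_simp; ring
          rw [this]
          exact div_nonneg (by linarith) hn0.le
        · rw [← sub_nonneg]
          have : 1 / (n : ℝ) - ((2 * k + 1) / (2 * (n : ℝ)) - s) =
            (1 - (2 * k + 1) / 2 + s * n) / n := by field_simp; ring
          rw [this]
          exact div_nonneg (by linarith) hn0.le
    · rw [abs_of_nonneg (sub_nonneg.2 hkn)]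
      push_cast
      field_simp
      ring
  · rw [Finset.sum_const, Finset.card_range, nsmul_eq_mul, mul_div_cancel₀ _ hn0.ne']
    linarith

/-! ### The potential of the pullback of the arcsine distribution -/

theorem ae_two_mul_cos_ne (x : ℝ) : ∀ᵐ θ : ℝ, 2 * x ≠ 2 * Real.cos θ := by
  by_cases hx : ∃ φ, Real.cos φ = x
  · obtain ⟨φ, rfl⟩ := hx
    have hcount : {θ : ℝ | ¬ 2 * Real.cos φ ≠ 2 * Real.cos θ}.Countable := by
      refine ((Set.countable_range fun k : ℤ => 2 * k * Real.pi + φ).union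
        (Set.countable_range fun k : ℤ => 2 * k * Real.pi - φ)).mono fun θ hθ => ?_
      have h : Real.cos φ = Real.cos θ := by
        have := not_ne_iff.1 hθ
        linarith
      obtain ⟨k, hk | hk⟩ := Real.cos_eq_cos_iff.1 h
      · exact Or.inl ⟨k, hk.symm⟩
      · exact Or.inr ⟨k, hk.symm⟩
    exact hcount.measure_zero volume
  · push Not at hx
    exact ae_of_all _ fun θ h => hx θ (by linarith)

/-- The identity `|u - v| |u - v⁻¹| = |v + v⁻¹ - u - u⁻¹|` for `u`, `v` on the unit circle. -/
theorem log_norm_circleMap_mul (φ θ : ℝ) (h : 2 * Real.cos φ ≠ 2 * Real.cos θ) :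
    Real.log ‖circleMap 0 1 θ - Complex.exp (φ * Complex.I)‖ +
      Real.log ‖circleMap 0 1 θ - Complex.exp (-(φ * Complex.I))‖ =
      Real.log |2 * Real.cos φ - 2 * Real.cos θ| := by
  set u := Complex.exp (θ * Complex.I) with hu
  set v := Complex.exp (φ * Complex.I) with hv
  have hu0 : u ≠ 0 := Complex.exp_ne_zero _
  have hv0 : v ≠ 0 := Complex.exp_ne_zero _
  have hcu : ((2 * Real.cos θ : ℝ) : ℂ) = u + u⁻¹ := by
    push_cast
    rw [Complex.two_cos, hu, ← Complex.exp_neg, neg_mul]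
  have hcv : ((2 * Real.cos φ : ℝ) : ℂ) = v + v⁻¹ := by
    push_cast
    rw [Complex.two_cos, hv, ← Complex.exp_neg, neg_mul]
  have hmul : (u - v) * (u - v⁻¹) =
      -u * ((2 * Real.cos φ - 2 * Real.cos θ : ℝ) : ℂ) := by
    rw [Complex.ofReal_sub, hcu, hcv]
    field_simp
    ring
  have hnorm : ‖u - v‖ * ‖u - v⁻¹‖ = |2 * Real.cos φ - 2 * Real.cos θ| := by
    rw [← norm_mul, hmul, norm_mul, norm_neg, Complex.norm_exp_ofReal_mul_I, one_mul,
      Complex.norm_real, Real.norm_eq_abs]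
  have hne : ‖u - v‖ * ‖u - v⁻¹‖ ≠ 0 := by
    rw [hnorm]
    exact abs_ne_zero.2 (sub_ne_zero.2 h)
  have hcirc : circleMap 0 1 θ = u := by simp [circleMap, hu]
  rw [hcirc, Complex.exp_neg, ← hnorm, Real.log_mul (left_ne_zero_of_mul hne)
    (right_ne_zero_of_mul hne)]

/-- The logarithmic potential of the arcsine distribution vanishes on `[-2, 2]`. The integrand is
the sum of the logarithmic distances from a point of the unit circle to `exp (± i φ)`, and the
circle average of each of them is zero. -/
theorem integral_log_abs_sub_two_mul_cos (φ : ℝ) :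
    IntervalIntegrable (fun s => Real.log |2 * Real.cos φ - 2 * Real.cos (Real.pi * s)|)
      volume 0 1 ∧
    ∫ s in (0 : ℝ)..1, Real.log |2 * Real.cos φ - 2 * Real.cos (Real.pi * s)| = 0 := by
  set H : ℝ → ℝ := fun θ => Real.log |2 * Real.cos φ - 2 * Real.cos θ| with hH
  have hcirc (a : ℂ) (ha : ‖a‖ = 1) :
      IntervalIntegrable (fun θ => Real.log ‖circleMap 0 1 θ - a‖) volume 0 (2 * Real.pi) ∧
      ∫ θ in (0 : ℝ)..2 * Real.pi, Real.log ‖circleMap 0 1 θ - a‖ = 0 := by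
    refine ⟨circleIntegrable_log_norm_sub_const (c := 0) (a := a) 1, ?_⟩
    have h := circleAverage_log_norm_sub_const₁ ha
    rw [Real.circleAverage_def, smul_eq_mul] at h
    exact (mul_eq_zero.1 h).resolve_left (inv_ne_zero (by positivity))
  obtain ⟨i1, e1⟩ := hcirc (Complex.exp (φ * Complex.I)) (Complex.norm_exp_ofReal_mul_I φ)
  obtain ⟨i2, e2⟩ := hcirc (Complex.exp (-(φ * Complex.I))) (by
    rw [Complex.exp_neg, norm_inv, Complex.norm_exp_ofReal_mul_I, inv_one])
  have hae : ∀ᵐ θ : ℝ, Real.log ‖circleMap 0 1 θ - Complex.exp (φ * Complex.I)‖ +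
      Real.log ‖circleMap 0 1 θ - Complex.exp (-(φ * Complex.I))‖ = H θ := by
    filter_upwards [ae_two_mul_cos_ne (Real.cos φ)] with θ hθ
    exact log_norm_circleMap_mul φ θ hθ
  have hint : IntervalIntegrable H volume 0 (2 * Real.pi) :=
    (i1.add i2).congr_ae (ae_restrict_of_ae hae)
  have hzero : ∫ θ in (0 : ℝ)..2 * Real.pi, H θ = 0 := by
    rw [← intervalIntegral.integral_congr_ae (hae.mono fun θ h _ => h),
      intervalIntegral.integral_add i1 i2, e1, e2, add_zero]
  have hpi := Real.pi_pos
  have h1 : IntervalIntegrable H volume 0 Real.pi := by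
    refine hint.mono_set ?_
    rw [Set.uIcc_of_le hpi.le, Set.uIcc_of_le (by linarith)]
    exact Set.Icc_subset_Icc_right (by linarith)
  have h2 : IntervalIntegrable H volume Real.pi (2 * Real.pi) := by
    refine hint.mono_set ?_
    rw [Set.uIcc_of_le (by linarith), Set.uIcc_of_le (by linarith)]
    exact Set.Icc_subset_Icc_left hpi.le
  have hsymm : ∫ θ in Real.pi..2 * Real.pi, H θ = ∫ θ in (0 : ℝ)..Real.pi, H θ := by
    have h := intervalIntegral.integral_comp_sub_left H (a := 0) (b := Real.pi) (2 * Real.pi)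
    rw [sub_zero, show 2 * Real.pi - Real.pi = Real.pi by ring] at h
    rw [← h]
    refine intervalIntegral.integral_congr fun θ _ => ?_
    simp only [hH, Real.cos_two_pi_sub]
  have hhalf : ∫ θ in (0 : ℝ)..Real.pi, H θ = 0 := by
    rw [← intervalIntegral.integral_add_adjacent_intervals h1 h2, hsymm] at hzero
    linarith
  constructor
  · have := h1.comp_mul_left (c := Real.pi)
    rw [zero_div, div_self hpi.ne'] at this
    exact this
  · have := intervalIntegral.integral_comp_mul_left H (a := 0) (b := 1) hpi.ne'
    rw [mul_zero, mul_one, hhalf, smul_zero] at this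
    exact this

section Potential

variable {Q : ℂ[X]}

/-- The potential of a fibre measure at a point `z` of the preimage, from the factorization
`Q(z) - y = lead Q * ∏ (z - ξ)` over the fibre above `y`. The first conjunct records that the
value is not truncated by `ENNReal.ofReal`. -/
theorem fibreSum_posLogKernel (hQ : 0 < Q.natDegree) {R : ℝ} (hR : 0 < R)
    (hK : ∀ z ∈ segmentPreimage Q, ∀ w ∈ segmentPreimage Q, ‖z - w‖ ≤ R) {z : ℂ} {x y : ℝ}
    (hx : x ∈ Set.Icc (-2 : ℝ) 2) (hy : y ∈ Set.Icc (-2 : ℝ) 2) (hxy : x ≠ y)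
    (hz : Q.eval z = x) :
    0 ≤ Real.log R + (Real.log ‖Q.leadingCoeff‖ - Real.log |x - y|) / Q.natDegree ∧
    (Q.natDegree : ℝ≥0∞)⁻¹ * fibreSum Q (posLogKernel R z) y =
      ENNReal.ofReal (Real.log R +
        (Real.log ‖Q.leadingCoeff‖ - Real.log |x - y|) / Q.natDegree) := by
  obtain ⟨ξ, hξ⟩ := (Q - C (y : ℂ)).roots.exists_eq_map_univ_fin (card_roots_sub_C (y : ℂ))
  have hξQ (i) : Q.eval (ξ i) = y := by
    refine (mem_roots_sub_C hQ).1 ?_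
    rw [hξ]
    exact Multiset.mem_map_of_mem _ (Finset.mem_univ i)
  have hne (i) : z ≠ ξ i := by
    rintro rfl
    rw [hξQ i] at hz
    exact hxy (Complex.ofReal_injective hz).symm
  have hpos (i) : 0 < ‖z - ξ i‖ := norm_pos_iff.2 (sub_ne_zero.2 (hne i))
  have hle (i) : ‖z - ξ i‖ ≤ R := hK z ⟨x, hx, hz⟩ (ξ i) ⟨y, hy, hξQ i⟩
  have hlog0 (i) : 0 ≤ Real.log (R / ‖z - ξ i‖) :=
    Real.log_nonneg ((one_le_div (hpos i)).2 (hle i))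
  have hprod : ‖Q.leadingCoeff‖ * ∏ i, ‖z - ξ i‖ = |x - y| := by
    have h := (IsAlgClosed.splits (Q - C (y : ℂ))).eval_eq_prod_roots z
    rw [leadingCoeff_sub_C hQ, eval_sub, eval_C, hξ, Multiset.map_map, hz] at h
    have h2 := congrArg norm h
    rw [← Complex.ofReal_sub, Complex.norm_real, Real.norm_eq_abs, norm_mul] at h2
    rw [h2, ← norm_prod]
    rfl
  have hlc : 0 < ‖Q.leadingCoeff‖ :=
    norm_pos_iff.2 (leadingCoeff_ne_zero.2 (ne_zero_of_natDegree_gt hQ))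
  have hr : (0 : ℝ) < Q.natDegree := by exact_mod_cast hQ
  have hsum : ∑ i, Real.log (R / ‖z - ξ i‖) =
      Q.natDegree * Real.log R + (Real.log ‖Q.leadingCoeff‖ - Real.log |x - y|) := by
    rw [← hprod, Real.log_mul hlc.ne' (Finset.prod_ne_zero_iff.2 fun i _ => (hpos i).ne'),
      Real.log_prod fun i _ => (hpos i).ne']
    simp only [Real.log_div hR.ne' (hpos _).ne', Finset.sum_sub_distrib]
    simp
    ring
  have hval : Real.log R + (Real.log ‖Q.leadingCoeff‖ - Real.log |x - y|) / Q.natDegree =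
      (∑ i, Real.log (R / ‖z - ξ i‖)) / Q.natDegree := by
    rw [hsum]
    field_simp
  rw [hval]
  refine ⟨div_nonneg (Finset.sum_nonneg fun i _ => hlog0 i) hr.le, ?_⟩
  have hfs : fibreSum Q (posLogKernel R z) y = ∑ i, posLogKernel R z (ξ i) := by
    rw [fibreSum, hξ, Multiset.map_map]
    rfl
  rw [hfs, ENNReal.ofReal_div_of_pos hr, ENNReal.ofReal_sum_of_nonneg fun i _ => hlog0 i,
    ENNReal.ofReal_natCast, mul_comm, div_eq_mul_inv]
  congr 1
  exact Finset.sum_congr rfl fun i _ => by rw [posLogKernel, if_neg (hne i)]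

/-- The logarithmic potential of the pullback of the arcsine distribution is constant on the
preimage of `[-2, 2]`. -/
theorem potential_arcsinePullback (hQ : 0 < Q.natDegree) {R : ℝ} (hR : 0 < R)
    (hK : ∀ z ∈ segmentPreimage Q, ∀ w ∈ segmentPreimage Q, ‖z - w‖ ≤ R) {z : ℂ}
    (hz : z ∈ segmentPreimage Q) :
    ∫⁻ w, posLogKernel R z w ∂(arcsinePullback Q) =
      ENNReal.ofReal (Real.log R + Real.log ‖Q.leadingCoeff‖ / Q.natDegree) := by
  obtain ⟨x, hx, hzx⟩ := hz
  set φ := Real.arccos (x / 2)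
  have hφ : x = 2 * Real.cos φ := by
    rw [Real.cos_arccos (by linarith [hx.1]) (by linarith [hx.2])]; ring
  have hmeas : Measurable (posLogKernel R z) :=
    (measurable_posLogKernel R).comp measurable_prodMk_left
  have hne : ∀ᵐ s ∂(volume.restrict (Set.Ioc (0 : ℝ) 1)), x ≠ 2 * Real.cos (Real.pi * s) := by
    refine ae_restrict_of_ae ?_
    have hq : Measure.QuasiMeasurePreserving (fun s : ℝ => Real.pi * s) volume volume :=
      ⟨by fun_prop, by
        rw [Real.map_volume_mul_left Real.pi_ne_zero]
        exact Measure.smul_absolutelyContinuous⟩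
    have := hq.ae (ae_two_mul_cos_ne (Real.cos φ))
    simpa only [← hφ] using this
  obtain ⟨hint, hzero⟩ := integral_log_abs_sub_two_mul_cos φ
  rw [← hφ] at hint hzero
  set g : ℝ → ℝ := fun s => Real.log R + (Real.log ‖Q.leadingCoeff‖ -
    Real.log |x - 2 * Real.cos (Real.pi * s)|) / Q.natDegree with hg
  have hgint : IntervalIntegrable g volume 0 1 :=
    (intervalIntegrable_const).add ((intervalIntegrable_const.sub hint).div_const _)
  have hgval : ∫ s in (0 : ℝ)..1, g s =
      Real.log R + Real.log ‖Q.leadingCoeff‖ / Q.natDegree := by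
    rw [hg, intervalIntegral.integral_add intervalIntegrable_const
      ((intervalIntegrable_const.sub hint).div_const _), intervalIntegral.integral_div,
      intervalIntegral.integral_sub intervalIntegrable_const hint, hzero]
    simp
  rw [lintegral_arcsinePullback hQ hmeas, ← hgval,
    intervalIntegral.integral_of_le zero_le_one, ofReal_integral_eq_lintegral_ofReal hgint.1]
  · refine lintegral_congr_ae ?_
    filter_upwards [hne] with s hs
    exact (fibreSum_posLogKernel hQ hR hK hx (two_mul_cos_mem _) hs hzx).2
  · filter_upwards [hne] with s hs
    exact (fibreSum_posLogKernel hQ hR hK hx (two_mul_cos_mem _) hs hzx).1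

/-- The pullback of the arcsine distribution, as a probability measure. -/
def arcsinePullbackProb (hQ : 0 < Q.natDegree) : ProbabilityMeasure ℂ :=
  ⟨arcsinePullback Q, isProbabilityMeasure_arcsinePullback hQ⟩

theorem isEquilibriumMeasure_arcsinePullback (hQ : 0 < Q.natDegree) :
    IsEquilibriumMeasure (segmentPreimage Q) (arcsinePullbackProb hQ) ∧
    ∀ ν : ProbabilityMeasure ℂ, IsEquilibriumMeasure (segmentPreimage Q) ν →
      ν = arcsinePullbackProb hQ := by
  obtain ⟨D, hD⟩ := Metric.isBounded_iff.1 (isCompact_segmentPreimage hQ).isBounded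
  have hK : ∀ z ∈ segmentPreimage Q, ∀ w ∈ segmentPreimage Q, ‖z - w‖ ≤ max 1 D := by
    intro z hz w hw
    rw [← dist_eq_norm]
    exact (hD hz hw).trans (le_max_right _ _)
  exact isEquilibriumMeasure_of_potential_const (le_max_left 1 D) hK (arcsinePullbackProb hQ)
    (arcsinePullback_compl hQ) ENNReal.ofReal_ne_top fun z hz =>
      potential_arcsinePullback hQ (zero_lt_one.trans_le (le_max_left 1 D)) hK hz

end Potential

/-! ### Zeros of the composed Chebyshev polynomials -/

/-- Taking a power multiplies the multiplicities of the zeros and the degree by the same factor. -/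
theorem zeroCountingMeasure_pow (p : ℂ[X]) {l : ℕ} (hl : 1 ≤ l) :
    zeroCountingMeasure (p ^ l) = zeroCountingMeasure p := by
  have hl0 : (l : ℝ≥0) ≠ 0 := by exact_mod_cast (by omega : l ≠ 0)
  rw [zeroCountingMeasure, zeroCountingMeasure, natDegree_pow, roots_pow, Multiset.map_nsmul,
    Multiset.sum_nsmul, ← Nat.cast_smul_eq_nsmul ℝ≥0, smul_smul, Nat.cast_mul, mul_inv,
    mul_right_comm, inv_mul_cancel₀ hl0, one_mul]

theorem zeroCountingMeasure_C_mul (p : ℂ[X]) {c : ℂ} (hc : c ≠ 0) :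
    zeroCountingMeasure (C c * p) = zeroCountingMeasure p := by
  rw [zeroCountingMeasure, zeroCountingMeasure, natDegree_C_mul hc, roots_C_mul _ hc]

theorem toMeasure_zeroCountingMeasure (p : ℂ[X]) :
    (zeroCountingMeasure p : Measure ℂ) =
      (p.natDegree : ℝ≥0)⁻¹ • (p.roots.map Measure.dirac).sum := by
  rw [zeroCountingMeasure, FiniteMeasure.toMeasure_smul]
  congr 1
  change FiniteMeasure.toMeasureAddMonoidHom _ = _
  rw [map_multiset_sum, Multiset.map_map]
  rfl

theorem lintegral_zeroCountingMeasure (p : ℂ[X]) {f : ℂ → ℝ≥0} (hf : Measurable f) :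
    ∫⁻ z, f z ∂(zeroCountingMeasure p : Measure ℂ) =
      ENNReal.ofReal ((p.natDegree : ℝ)⁻¹ * (p.roots.map fun z => (f z : ℝ)).sum) := by
  have h (s : Multiset ℂ) : (s.map fun z => (f z : ℝ)).sum = ((s.map f).sum : ℝ≥0) := by
    induction s using Multiset.induction_on <;> simp_all
  have h' (s : Multiset ℂ) : (s.map fun z => (f z : ℝ≥0∞)).sum = ((s.map f).sum : ℝ≥0) := by
    induction s using Multiset.induction_on <;> simp_all
  have e : ((p.natDegree : ℝ)⁻¹ * ((p.roots.map f).sum : ℝ≥0) : ℝ) =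
      (((p.natDegree : ℝ≥0)⁻¹ * (p.roots.map f).sum : ℝ≥0) : ℝ) := by push_cast; rfl
  rw [toMeasure_zeroCountingMeasure, lintegral_smul_measure,
    lintegral_sum_map_dirac _ hf.coe_nnreal_ennreal, h, h', e, ENNReal.ofReal_coe_nnreal,
    ENNReal.coe_mul]
  rfl

/-- The factorization of the Chebyshev polynomial of `[-2, 2]`. -/
theorem chebyshev_C_eq_prod {n : ℕ} (hn : 1 ≤ n) :
    Chebyshev.C ℂ (n : ℤ) = ∏ k ∈ Finset.range n,
      (X - C ((2 * Real.cos (Real.pi * ((2 * k + 1) / (2 * n))) : ℝ) : ℂ)) := by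
  obtain ⟨hm, hd⟩ := monic_natDegree_chebyshev_C hn
  have hn0 : (n : ℝ) ≠ 0 := by exact_mod_cast (by omega : n ≠ 0)
  set x : ℕ → ℂ := fun k => ((2 * Real.cos (Real.pi * ((2 * k + 1) / (2 * n))) : ℝ) : ℂ) with hx
  have hinj : Set.InjOn x (Finset.range n) := by
    have h := (Finset.range n).nodup_map_iff_injOn.1 (Chebyshev.roots_T_real_nodup n)
    intro i hi j hj hij
    refine h hi hj ?_
    have := Complex.ofReal_injective hij
    simp only at this ⊢
    rw [show (2 * (i : ℝ) + 1) * Real.pi / (2 * n) = Real.pi * ((2 * i + 1) / (2 * n)) by ring,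
      show (2 * (j : ℝ) + 1) * Real.pi / (2 * n) = Real.pi * ((2 * j + 1) / (2 * n)) by ring]
    linarith
  have hroots : (Chebyshev.C ℂ (n : ℤ)).roots = ((Finset.range n).image x).val := by
    refine roots_eq_of_degree_eq_card (fun z hz => ?_) ?_
    · obtain ⟨k, -, rfl⟩ := Finset.mem_image.1 hz
      simp only [hx]
      rw [← Chebyshev.complex_ofReal_eval_C, Chebyshev.C_two_mul_real_cos, Complex.ofReal_eq_zero,
        mul_eq_zero]
      right
      rw [Real.cos_eq_zero_iff]
      refine ⟨k, ?_⟩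
      push_cast
      field_simp
    · rw [Finset.card_image_of_injOn hinj, Finset.card_range, degree_eq_natDegree hm.ne_zero, hd]
  have hprod := (IsAlgClosed.splits (Chebyshev.C ℂ (n : ℤ))).eq_prod_roots
  rw [hm.leadingCoeff, C_1, one_mul, hroots, Finset.image_val_of_injOn hinj,
    Multiset.map_map] at hprod
  exact hprod

/-- The zero counting measures of the Chebyshev polynomials composed with `Q` converge weakly to
the pullback of the arcsine distribution: tested against a continuous function they are midpoint
Riemann sums. -/
theorem tendsto_zeroCountingMeasure_comp {Q : ℂ[X]} (hQ : 0 < Q.natDegree) :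
    Tendsto (fun n : ℕ => zeroCountingMeasure ((Chebyshev.C ℂ (n : ℤ)).comp Q)) atTop
      (𝓝 (arcsinePullbackProb hQ).toFiniteMeasure) := by
  rw [FiniteMeasure.tendsto_iff_forall_lintegral_tendsto]
  intro f
  have hfc : Continuous fun z => (f z : ℝ) := NNReal.continuous_coe.comp f.continuous
  set g : ℝ → ℝ := fun s => (Q.natDegree : ℝ)⁻¹ *
    fibreSum Q (fun z => (f z : ℝ)) ((2 * Real.cos (Real.pi * s) : ℝ) : ℂ) with hg
  have hgc : Continuous g :=
    ((continuous_fibreSum hQ hfc).comp (by fun_prop)).const_mul _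
  have hg0 (s) : 0 ≤ g s := by
    refine mul_nonneg (by positivity) (Multiset.sum_nonneg fun y hy => ?_)
    obtain ⟨z, -, rfl⟩ := Multiset.mem_map.1 hy
    exact (f z).coe_nonneg
  have hlim : ∫⁻ z, f z ∂((arcsinePullbackProb hQ).toFiniteMeasure : Measure ℂ) =
      ENNReal.ofReal (∫ s in (0 : ℝ)..1, g s) := by
    change ∫⁻ z, f z ∂(arcsinePullback Q) = _
    rw [lintegral_arcsinePullback hQ f.continuous.measurable.coe_nnreal_ennreal,
      intervalIntegral.integral_of_le zero_le_one,
      ofReal_integral_eq_lintegral_ofReal (hgc.intervalIntegrable 0 1).1 (ae_of_all _ hg0)]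
    refine lintegral_congr fun s => ?_
    have h (s : Multiset ℂ) : (s.map fun z => (f z : ℝ≥0∞)).sum =
        ENNReal.ofReal (s.map fun z => (f z : ℝ)).sum := by
      have h1 : (s.map fun z => (f z : ℝ)).sum = ((s.map f).sum : ℝ≥0) := by
        induction s using Multiset.induction_on <;> simp_all
      rw [h1, ENNReal.ofReal_coe_nnreal]
      induction s using Multiset.induction_on <;> simp_all
    rw [fibreSum, h, hg, ENNReal.ofReal_mul (by positivity),
      ENNReal.ofReal_inv_of_pos (by exact_mod_cast hQ), ENNReal.ofReal_natCast]
    rfl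
  rw [hlim]
  refine ((ENNReal.continuous_ofReal.tendsto _).comp (tendsto_midpoint_sum hgc)).congr' ?_
  filter_upwards [eventually_ge_atTop 1] with n hn
  have hdeg : ((Chebyshev.C ℂ (n : ℤ)).comp Q).natDegree = n * Q.natDegree := by
    rw [natDegree_comp, (monic_natDegree_chebyshev_C hn).2]
  have hroots : ((Chebyshev.C ℂ (n : ℤ)).comp Q).roots = (Finset.range n).val.bind fun k =>
      (Q - C ((2 * Real.cos (Real.pi * ((2 * k + 1) / (2 * n))) : ℝ) : ℂ)).roots := by
    rw [chebyshev_C_eq_prod hn, Polynomial.prod_comp]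
    simp only [sub_comp, X_comp, C_comp]
    exact roots_prod _ _ (Finset.prod_ne_zero_iff.2 fun k _ => sub_C_ne_zero hQ _)
  rw [Function.comp_apply, lintegral_zeroCountingMeasure _ f.continuous.measurable, hdeg, hroots,
    Multiset.map_bind, Multiset.sum_bind]
  congr 1
  rw [Nat.cast_mul, mul_inv, mul_assoc, hg, ← Finset.mul_sum]
  rfl

/-! ### Periodic Jacobi operators -/

theorem natDegree_naimanTilde {r : ℕ} (hr : 0 < r) {a b : ℤ → ℂ} (hb0 : ∀ n, b n ≠ 0) :
    (naimanTilde r a b).natDegree = r ∧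
      (naimanTilde r a b).leadingCoeff = (jacobiModulus r b)⁻¹ := by
  have hB : (jacobiModulus r b)⁻¹ ≠ 0 := inv_ne_zero (offDiagProd_ne_zero b hb0 r)
  obtain ⟨h1, h2⟩ := natDegree_coeff_naimanPoly r hr a b
  have hd : (naimanPoly r a b).natDegree = r :=
    le_antisymm h1 (le_natDegree_of_ne_zero (by rw [h2]; exact one_ne_zero))
  rw [naimanTilde, natDegree_C_mul hB, leadingCoeff_mul, leadingCoeff_C, leadingCoeff, hd, h2,
    mul_one]
  exact ⟨rfl, rfl⟩

end

theorem mainTheorem4 (r : ℕ) (hr : 0 < r) (a b : EllInfty)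
    (ha : ∀ n : ℤ, a (n + r) = a n) (hb : ∀ n : ℤ, b (n + r) = b n)
    (hb0 : ∀ n : ℤ, b n ≠ 0) :
    (∀ n : ℕ, 1 ≤ n →
      IsChebyshevPolynomial (spectrum ℂ (jacobiOp a b)) (n * r)
        (C (chebPoly r a b n).leadingCoeff⁻¹ * chebPoly r a b n)) ∧
    ∃ μ : ProbabilityMeasure ℂ,
      IsEquilibriumMeasure (spectrum ℂ (jacobiOp a b)) μ ∧
      (∀ ν : ProbabilityMeasure ℂ,
        IsEquilibriumMeasure (spectrum ℂ (jacobiOp a b)) ν → ν = μ) ∧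
      Tendsto (fun n : ℕ => zeroCountingMeasure (chebPoly r a b n)) atTop
        (𝓝 μ.toFiniteMeasure) ∧
      ∀ l : ℕ, 1 ≤ l →
        Tendsto (fun n : ℕ => zeroCountingMeasure (chebPoly r a b n ^ l)) atTop
          (𝓝 μ.toFiniteMeasure) := by
  obtain ⟨hdeg, hlead⟩ := natDegree_naimanTilde (a := a) hr hb0
  have hQ : 0 < (naimanTilde r a b).natDegree := hdeg.symm ▸ hr
  have hB : jacobiModulus r b ≠ 0 := offDiagProd_ne_zero b hb0 r
  have hβ (n : ℕ) : (((2 * ‖jacobiModulus r b‖ : ℝ) : ℂ) ^ n)⁻¹ ≠ 0 :=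
    inv_ne_zero (pow_ne_zero _ (Complex.ofReal_ne_zero.2
      (mul_ne_zero two_ne_zero (norm_ne_zero_iff.2 hB))))
  rw [spectrum_jacobiOp r hr a b ha hb hb0]
  have hzeros : Tendsto (fun n : ℕ => zeroCountingMeasure (chebPoly r a b n)) atTop
      (𝓝 (arcsinePullbackProb hQ).toFiniteMeasure) := by
    have h (n : ℕ) : zeroCountingMeasure (chebPoly r a b n) =
        zeroCountingMeasure ((Chebyshev.C ℂ (n : ℤ)).comp (naimanTilde r a b)) :=
      zeroCountingMeasure_C_mul _ (hβ n)
    simp only [h]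
    exact tendsto_zeroCountingMeasure_comp hQ
  obtain ⟨heq, huniq⟩ := isEquilibriumMeasure_arcsinePullback hQ
  refine ⟨fun n hn => ?_, arcsinePullbackProb hQ, heq, huniq, hzeros, fun l hl => ?_⟩
  · have h := isChebyshevPolynomial_comp hQ hn
    rw [hdeg] at h
    convert h using 1
    obtain ⟨hm, hd⟩ := monic_natDegree_chebyshev_C hn
    have hβn := hβ n
    rw [chebPoly, leadingCoeff_mul, leadingCoeff_C, leadingCoeff_comp hQ.ne', hm.leadingCoeff, hd,
      one_mul, mul_inv, ← mul_assoc, ← C_mul, mul_right_comm, inv_mul_cancel₀ hβn, one_mul]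
  · simpa only [zeroCountingMeasure_pow _ hl] using hzeros
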